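/- Let $(Y,g)$ be a compact smooth Riemannian manifold without boundary, of dimension $m$, with Riemannian distance $d$ (infinite between different components) and Riemannian volume $\nu$. Let $V$ be a smooth vector field on $Y$ with flow $\varphi_t=e^{tV}$, and assume that it is Anosov: $V$ vanishes nowhere, and there are a continuous splitting $TY=\mathbb{R}V\oplus E^u\oplus E^s$, with $E^u,E^s$ invariant under the flow, and constants $C_0,c>0$ such that $\|d\varphi_t|_{E^s}\|\le C_0e^{-ct}$ and $\|d\varphi_{-t}|_{E^u}\|\le C_0e^{-ct}$ for all $t>0$. Let $$\Lambda_{\max}=\limsup_{t\to\infty}\,t^{-1}\sup_{y\in Y}\ln\|d\varphi_t(y)\|$$ be the maximal expansion rate and let $T_0$ be the shortest period, i.e. the infimum of all $t>0$ such that $\varphi_t(y)=y$ for some $y\in Y$. For $\varepsilon>0$ and $T>\tfrac12T_0$ define the lifted recurrence set $$\tilde S_{T,\varepsilon}=\{(y,t)\in Y\times\mathbb{R} : \tfrac12T_0\le t\le T,\ d(\varphi_t(y),y)\le\varepsilon\},$$ the recurrence set $S_{T,\varepsilon}=\pi_Y(\tilde S_{T,\varepsilon})\subset Y$ and the extended recurrence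 set $S^e_{T,\varepsilon}=\{y\in Y: d(y,S_{T,\varepsilon})\le\varepsilon\}$. Then for each $\lambda>\Lambda_{\max}$ there is a constant $C>0$, independent of $\varepsilon$ and $T$, such that for all $\varepsilon>0$ and all $T>\tfrac12T_0$ $$(\nu\otimes dt)\big(\tilde S_{T,\varepsilon}\big)\le C\,\varepsilon^{m}e^{m\lambda T},$$ and moreover $$\nu(S_{T,\varepsilon})\le C\,\varepsilon^{m-1}e^{m\lambda T},\qquad \nu(S^e_{T,\varepsilon})\le C\,\varepsilon^{m-1}e^{m\lambda T}.$$ -/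

import Mathlib

open Set Filter Topology MeasureTheory Manifold Bundle
open scoped ENNReal ContDiff

noncomputable section

namespace AnosovRecurrence

section Flow

variable {m : ℕ} {Y : Type*} [TopologicalSpace Y] [ChartedSpace (EuclideanSpace ℝ (Fin m)) Y]
  [IsManifold (𝓡 m) ∞ Y]

/-- A vector field (a section of the tangent bundle, not necessarily continuous) seen as a map
into the total space of the tangent bundle. -/
def toSection (X : ∀ y : Y, TangentSpace (𝓡 m) y) (y : Y) : TangentBundle (𝓡 m) Y := ⟨y, X y⟩

/-- `φ` is the (smooth) flow `e^{tV}` generated by the vector field `V`: the map `(t, y) ↦ φ t y`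
is smooth and its curves are the integral curves of `V`. The group law is part of `Flow`. -/
structure IsFlowOf (φ : Flow ℝ Y) (V : ∀ y : Y, TangentSpace (𝓡 m) y) : Prop where
  smooth : ContMDiff (𝓘(ℝ, ℝ).prod (𝓡 m)) (𝓡 m) ∞ (fun p : ℝ × Y => φ p.1 p.2)
  integralCurve : ∀ y : Y, IsMIntegralCurve (I := 𝓡 m) (fun t => φ t y) V

/-- A family of subspaces of the tangent spaces is a continuous subbundle: near each point it has
a frame of continuous vector fields. -/
def IsContinuousSubbundle (F : ∀ y : Y, Submodule ℝ (TangentSpace (𝓡 m) y)) : Prop :=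
  ∀ y₀ : Y, ∃ (k : ℕ) (X : Fin k → ∀ y : Y, TangentSpace (𝓡 m) y), ∃ U ∈ 𝓝 y₀,
    (∀ i, ContinuousOn (toSection (X i)) U) ∧
    ∀ y ∈ U, LinearIndependent ℝ (fun i => X i y) ∧
      Submodule.span ℝ (range fun i => X i y) = F y

/-- A family of subspaces of the tangent spaces is invariant under the flow. -/
def IsInvariantSubbundle (φ : Flow ℝ Y) (F : ∀ y : Y, Submodule ℝ (TangentSpace (𝓡 m) y)) :
    Prop :=
  ∀ (t : ℝ) (y : Y),
    (F y).map (mfderiv (𝓡 m) (𝓡 m) (φ t) y).toLinearMap = F (φ t y)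

/-- The shortest period `T₀` of a flow: the infimum of all `t > 0` with `φ t y = y` for some `y`
(it is `∞` if there is no periodic orbit). -/
def shortestPeriod (φ : Flow ℝ Y) : ℝ≥0∞ :=
  ⨅ t ∈ {t : ℝ | 0 < t ∧ ∃ y : Y, φ t y = y}, ENNReal.ofReal t

end Flow

section Riemannian

variable {m : ℕ} {Y : Type*} [TopologicalSpace Y] [ChartedSpace (EuclideanSpace ℝ (Fin m)) Y]
  [IsManifold (𝓡 m) ∞ Y] [RiemannianBundle (fun y : Y => TangentSpace (𝓡 m) y)]

/-- The flow `φ` of `V` is Anosov: `V` vanishes nowhere and there is a continuous, flow-invariant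
splitting `TY = ℝV ⊕ Eᵘ ⊕ Eˢ` for which `φ t` contracts `Eˢ` and `φ (-t)` contracts `Eᵘ`
exponentially, uniformly for `t > 0`. With the constant `C` allowed, the condition does not depend
on the Riemannian metric of a compact manifold, and it holds with `C = 1` for a suitable metric. -/
def IsAnosov (φ : Flow ℝ Y) (V : ∀ y : Y, TangentSpace (𝓡 m) y) : Prop :=
  (∀ y : Y, V y ≠ 0) ∧
  ∃ Eu Es : ∀ y : Y, Submodule ℝ (TangentSpace (𝓡 m) y),
    (∀ y : Y, DirectSum.IsInternal ![Submodule.span ℝ {V y}, Eu y, Es y]) ∧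
    IsContinuousSubbundle Eu ∧ IsContinuousSubbundle Es ∧
    IsInvariantSubbundle φ Eu ∧ IsInvariantSubbundle φ Es ∧
    ∃ C c : ℝ, 0 < C ∧ 0 < c ∧ ∀ t : ℝ, 0 < t → ∀ y : Y,
      (∀ v ∈ Es y, ‖mfderiv (𝓡 m) (𝓡 m) (φ t) y v‖ ≤ C * Real.exp (-c * t) * ‖v‖) ∧
      (∀ v ∈ Eu y, ‖mfderiv (𝓡 m) (𝓡 m) (φ (-t)) y v‖ ≤ C * Real.exp (-c * t) * ‖v‖)

variable (m) in
/-- The maximal expansion rate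
`Λ_max = limsup_{t → ∞} t⁻¹ sup_y log ‖dφ_t(y)‖` (operator norm for the Riemannian metric). -/
def maximalExpansionRate (φ : Flow ℝ Y) : EReal :=
  limsup (fun t : ℝ =>
    ⨆ y : Y, ((t⁻¹ * Real.log ‖mfderiv (𝓡 m) (𝓡 m) (φ t) y‖ : ℝ) : EReal)) atTop

end Riemannian

section Recurrence

variable {Y : Type*} [EMetricSpace Y]

/-- The lifted recurrence set in `Y × ℝ`: pairs `(y, t)` with `T₀ / 2 ≤ t ≤ T` and
`d(φ_t y, y) ≤ ε`. -/
def liftedRecurrenceSet (φ : Flow ℝ Y) (T ε : ℝ) : Set (Y × ℝ) :=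
  {p | 0 ≤ p.2 ∧ shortestPeriod φ / 2 ≤ ENNReal.ofReal p.2 ∧ p.2 ≤ T ∧
    edist (φ p.2 p.1) p.1 ≤ ENNReal.ofReal ε}

/-- The recurrence set `S_{T,ε}`, the projection of the lifted one to `Y`. -/
def recurrenceSet (φ : Flow ℝ Y) (T ε : ℝ) : Set Y :=
  {y | ∃ t : ℝ, (y, t) ∈ liftedRecurrenceSet φ T ε}

/-- The extended recurrence set `S^e_{T,ε}`: points at distance at most `ε` from `S_{T,ε}`. -/
def extendedRecurrenceSet (φ : Flow ℝ Y) (T ε : ℝ) : Set Y :=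
  {y | Metric.infEDist y (recurrenceSet φ T ε) ≤ ENNReal.ofReal ε}

variable [MeasurableSpace Y] [BorelSpace Y]

variable (Y) in
/-- The Riemannian volume of an `m`-dimensional Riemannian manifold whose extended distance is the
Riemannian one: the `m`-dimensional Hausdorff measure, normalized to be Lebesgue measure on
`ℝ^m`. -/
def riemannianVolume (m : ℕ) : Measure Y := Measure.euclideanHausdorffMeasure m

end Recurrence

end AnosovRecurrence

end

open scoped NNReal

set_option linter.unusedSectionVars false

noncomputable section

namespace AnosovRecurrence

/-! Fix `l` with `Λ_max < l < lam`. Over times up to `T` the flow expands distances by at most a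
constant times `exp (l T)`, so points in a common ball of radius `ρ exp (-l T)` have orbits that
stay `δ`-close up to time `T`. About `exp (m l T)` such balls cover `Y` (`exists_cover`), and `O(T +
1)` windows of length `δ` contain all return times.

The heart is `IsAnosov.exists_closing`: if two points return `ε`-close to themselves at times in one
window and shadow each other for one period, then up to a time shift of size at most 1 they are `K
ε`-close. Hence each pair (ball, window) contributes a single flow tube of width `O(ε)`, of volume
`O(ε ^ (m - 1))`, and `S^e` has volume `O((T + 1) exp (m l T) ε ^ (m - 1))`. For a fixed point, the
speed bound confines the return times to a set of length `O(ε (T + 1))`, which by Fubini supplies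
the extra factor `ε` for the lifted set. The factor `(T + 1) ^ 2` is absorbed by `exp (m (lam - l)
T)`.

The closing estimate is proved by contradiction and rescaling. In a sequence of counterexamples, let
`M` be the largest distance between the two orbits modulo time shifts; then `M → 0` and `ε / M → 0`.
Since both orbits almost close up with almost equal periods, the displacement is `O(M)` over any
bounded time interval around a nearly maximal time. Dividing by `M` and passing to the limit gives a
tangent vector whose whole orbit under the flow is bounded modulo `V`. By hyperbolicity
(`IsAnosov.exists_eq_smul_of_bounded`) it is a multiple of `V`, so a time shift reduces the
displacement to `o(M)`, against near maximality. -/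

/-- Turns local constants into a uniform one. Where the bound involves `K⁻¹`, the clause `0 < K` is
included in `P` to keep it monotone in `K`. -/
theorem _root_.IsCompact.exists_bound_of_eventually {X : Type*} [TopologicalSpace X] {s : Set X}
    (hs : IsCompact s) {P : X → ℝ → Prop} (mono : ∀ x a b, a ≤ b → P x a → P x b)
    (h : ∀ x ∈ s, ∃ K, ∀ᶠ y in 𝓝 x, P y K) : ∃ K : ℝ, 0 < K ∧ ∀ x ∈ s, P x K := by
  refine hs.induction_on (p := fun u => ∃ K : ℝ, 0 < K ∧ ∀ x ∈ u, P x K) ⟨1, one_pos, by simp⟩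
    ?_ ?_ ?_
  · rintro u v huv ⟨K, hK, H⟩
    exact ⟨K, hK, fun x hx => H x (huv hx)⟩
  · rintro u v ⟨K, hK, H⟩ ⟨K', hK', H'⟩
    refine ⟨max K K', lt_max_of_lt_left hK, ?_⟩
    rintro x (hx | hx)
    · exact mono x _ _ (le_max_left _ _) (H x hx)
    · exact mono x _ _ (le_max_right _ _) (H' x hx)
  · intro x hx
    obtain ⟨K, hK⟩ := h x hx
    exact ⟨_, mem_nhdsWithin_of_mem_nhds hK, max K 1, lt_max_of_lt_right one_pos,
      fun y hy => mono y _ _ (le_max_left _ _) hy⟩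

section FlowGeometry

variable {m : ℕ} {Y : Type*} [EMetricSpace Y] [ChartedSpace (EuclideanSpace ℝ (Fin m)) Y]
  [IsManifold (𝓡 m) ∞ Y] [RiemannianBundle (fun y : Y => TangentSpace (𝓡 m) y)]
  [IsContMDiffRiemannianBundle (𝓡 m) ∞ (EuclideanSpace ℝ (Fin m))
      (fun y : Y => TangentSpace (𝓡 m) y)]
  [IsRiemannianManifold (𝓡 m) Y]

local notation "𝔼" => EuclideanSpace ℝ (Fin m)

variable {V : ∀ y : Y, TangentSpace (𝓡 m) y} {φ : Flow ℝ Y}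

/-! ### Riemannian distance, Lipschitz maps and charts. -/

theorem isContinuousRiemannianBundle_tangentSpace :
    IsContinuousRiemannianBundle 𝔼 (fun y : Y => TangentSpace (𝓡 m) y) := by
  obtain ⟨g, hg, h⟩ := IsContMDiffRiemannianBundle.exists_contMDiff (IB := 𝓡 m) (n := ∞)
    (F := 𝔼) (E := fun y : Y => TangentSpace (𝓡 m) y)
  exact ⟨g, hg.continuous, h⟩

theorem enorm_le_mul_enorm_of_norm_le {A B : Type*} [SeminormedAddGroup A] [SeminormedAddGroup B]
    {a : A} {b : B} {K : ℝ≥0} (h : ‖a‖ ≤ K * ‖b‖) : ‖a‖ₑ ≤ K * ‖b‖ₑ := by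
  simp only [enorm]
  exact_mod_cast (show ‖a‖₊ ≤ K * ‖b‖₊ from h)

/-- The distance is an infimum of lengths. For `K = 0` this would fail between different components:
no curve joins the points, and `0 * ⊤ = 0`. -/
theorem le_mul_edist_of_le_mul_pathELength {a : ℝ≥0∞} {K : ℝ≥0} (hK : K ≠ 0) (x y : Y)
    (h : ∀ γ : ℝ → Y, γ 0 = x → γ 1 = y → ContMDiffOn 𝓘(ℝ, ℝ) (𝓡 m) 1 γ (Icc 0 1) →
      a ≤ K * pathELength (𝓡 m) γ 0 1) : a ≤ K * edist x y := by
  rw [IsRiemannianManifold.out (I := 𝓡 m) x y,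
    ← ENNReal.div_le_iff' (by simpa using hK) ENNReal.coe_ne_top]
  refine le_of_forall_gt fun r hr => ?_
  obtain ⟨γ, h0, h1, hγ, hl⟩ := exists_lt_of_riemannianEDist_lt hr
  exact (ENNReal.div_le_of_le_mul' (h γ h0 h1 hγ)).trans_lt hl

/-- A `C^1` map whose derivative is bounded by `K` is `K`-Lipschitz for the Riemannian distance. -/
theorem edist_map_le_of_norm_mfderiv_le {f : Y → Y} (hf : ContMDiff (𝓡 m) (𝓡 m) 1 f) {K : ℝ≥0}
    (hK0 : K ≠ 0)
    (hK : ∀ y (v : TangentSpace (𝓡 m) y), ‖mfderiv (𝓡 m) (𝓡 m) f y v‖ ≤ K * ‖v‖) (x y : Y) :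
    edist (f x) (f y) ≤ K * edist x y := by
  refine le_mul_edist_of_le_mul_pathELength (m := m) hK0 x y fun γ h0 h1 hγ => ?_
  rw [IsRiemannianManifold.out (I := 𝓡 m) (f x)]
  have : riemannianEDist (𝓡 m) (f x) (f y) ≤ pathELength (𝓡 m) (f ∘ γ) 0 1 :=
    riemannianEDist_le_pathELength (hf.comp_contMDiffOn hγ) (by simp [h0]) (by simp [h1])
      zero_le_one
  refine this.trans ?_
  rw [pathELength_eq_lintegral_mfderivWithin_Icc, pathELength_eq_lintegral_mfderivWithin_Icc,
    ← lintegral_const_mul' _ _ ENNReal.coe_ne_top]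
  refine setLIntegral_mono' measurableSet_Icc fun t ht => ?_
  have hU : UniqueMDiffWithinAt 𝓘(ℝ, ℝ) (Icc (0 : ℝ) 1) t :=
    (uniqueDiffOn_Icc zero_lt_one t ht).uniqueMDiffWithinAt
  rw [mfderiv_comp_mfderivWithin t (hf.mdifferentiableAt one_ne_zero)
    (hγ.mdifferentiableOn one_ne_zero t ht) hU]
  exact enorm_le_mul_enorm_of_norm_le (hK _ _)

/-- A vector-valued `C^1` map whose derivative is bounded by `K` is `K`-Lipschitz for the
Riemannian distance. -/
theorem edist_le_of_norm_mfderiv_vector_le {f : Y → 𝔼} (hf : ContMDiff (𝓡 m) 𝓘(ℝ, 𝔼) 1 f)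
    {K : ℝ≥0} (hK0 : K ≠ 0)
    (hK : ∀ y (v : TangentSpace (𝓡 m) y), ‖(id (mfderiv (𝓡 m) 𝓘(ℝ, 𝔼) f y v) : 𝔼)‖ ≤ K * ‖v‖)
    (x y : Y) : edist (f x) (f y) ≤ K * edist x y := by
  refine le_mul_edist_of_le_mul_pathELength (m := m) hK0 x y fun γ h0 h1 hγ => ?_
  have hc : ContDiffOn ℝ 1 (f ∘ γ) (Icc 0 1) :=
    contMDiffOn_iff_contDiffOn.1 (hf.comp_contMDiffOn hγ)
  have := enorm_sub_le_lintegral_derivWithin_Icc_of_contDiffOn_Icc hc zero_le_one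
  rw [edist_comm, edist_eq_enorm_sub]
  simp only [Function.comp, h0, h1] at this
  refine this.trans ?_
  rw [pathELength_eq_lintegral_mfderivWithin_Icc,
    ← lintegral_const_mul' _ _ ENNReal.coe_ne_top]
  refine setLIntegral_mono' measurableSet_Icc fun t ht => ?_
  have hU : UniqueMDiffWithinAt 𝓘(ℝ, ℝ) (Icc (0 : ℝ) 1) t :=
    (uniqueDiffOn_Icc zero_lt_one t ht).uniqueMDiffWithinAt
  have e := mfderiv_comp_mfderivWithin (I := 𝓘(ℝ, ℝ)) (I' := 𝓡 m) (I'' := 𝓘(ℝ, 𝔼)) t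
    (hf.mdifferentiableAt one_ne_zero)
    (hγ.mdifferentiableOn one_ne_zero t ht) hU
  have e2 : derivWithin (f ∘ γ) (Icc 0 1) t =
      (id (mfderiv (𝓡 m) 𝓘(ℝ, 𝔼) f (γ t) (mfderivWithin 𝓘(ℝ, ℝ) (𝓡 m) γ (Icc 0 1) t 1)) : 𝔼) := by
    rw [← fderivWithin_derivWithin, ← mfderivWithin_eq_fderivWithin, e]
    rfl
  change ‖derivWithin (f ∘ γ) (Icc 0 1) t‖ₑ ≤ _
  rw [e2]
  exact enorm_le_mul_enorm_of_norm_le (hK _ _)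

/-- The derivative of the chart at `c` is the trivialization of the tangent bundle at `c`, which is
locally bounded together with its inverse because the metric is continuous. The ascription through
`id` reads the image as a vector of `𝔼`, with the Euclidean norm. -/
theorem exists_chart_norm_bound (c : Y) : ∃ C : ℝ, 0 < C ∧ ∀ᶠ y in 𝓝 c,
    y ∈ (chartAt 𝔼 c).source ∧ ∀ v : TangentSpace (𝓡 m) y,
    ‖(id (mfderiv (𝓡 m) 𝓘(ℝ, 𝔼) (extChartAt (𝓡 m) c) y v) : 𝔼)‖ ≤ C * ‖v‖ ∧
    ‖v‖ ≤ C * ‖(id (mfderiv (𝓡 m) 𝓘(ℝ, 𝔼) (extChartAt (𝓡 m) c) y v) : 𝔼)‖ := by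
  have := isContinuousRiemannianBundle_tangentSpace (m := m) (Y := Y)
  obtain ⟨C₁, h₁, H₁⟩ := eventually_norm_trivializationAt_lt 𝔼
    (fun y : Y => TangentSpace (𝓡 m) y) c
  obtain ⟨C₂, h₂, H₂⟩ := eventually_norm_symmL_trivializationAt_lt 𝔼
    (fun y : Y => TangentSpace (𝓡 m) y) c
  refine ⟨max C₁ C₂, lt_max_of_lt_left h₁, ?_⟩
  filter_upwards [H₁, H₂, chart_source_mem_nhds 𝔼 c] with y hy₁ hy₂ hy
  refine ⟨hy, fun v => ?_⟩
  have e : (id (mfderiv (𝓡 m) 𝓘(ℝ, 𝔼) (extChartAt (𝓡 m) c) y v) : 𝔼) =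
      (trivializationAt 𝔼 (fun y : Y => TangentSpace (𝓡 m) y) c).continuousLinearMapAt ℝ y v := by
    rw [TangentBundle.continuousLinearMapAt_trivializationAt hy]; rfl
  rw [e]
  refine ⟨(ContinuousLinearMap.le_of_opNorm_le _ hy₁.le v).trans (by gcongr; exact le_max_left _ _),
    ?_⟩
  have hb : y ∈ (trivializationAt 𝔼 (fun y : Y => TangentSpace (𝓡 m) y) c).baseSet := by
    simpa using hy
  have := (trivializationAt 𝔼 (fun y : Y => TangentSpace (𝓡 m) y) c).symmL_continuousLinearMapAt
    (R := ℝ) hb v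
  conv_lhs => rw [← this]
  exact (ContinuousLinearMap.le_of_opNorm_le _ hy₂.le _).trans
    (by gcongr; exact le_max_right _ _)

theorem contDiffAt_comp_chart_symm {F : ℝ × Y → 𝔼} {t₀ : ℝ} {c : Y}
    (hF : ContMDiffAt (𝓘(ℝ, ℝ).prod (𝓡 m)) 𝓘(ℝ, 𝔼) 1 F (t₀, c)) :
    ContDiffAt ℝ 1 (fun p : ℝ × 𝔼 => F (p.1, (extChartAt (𝓡 m) c).symm p.2))
      (t₀, extChartAt (𝓡 m) c c) := by
  have h1 : ContMDiffAt 𝓘(ℝ, 𝔼) (𝓡 m) 1 (extChartAt (𝓡 m) c).symm (extChartAt (𝓡 m) c c) :=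
    (contMDiffOn_extChartAt_symm c).contMDiffAt (extChartAt_target_mem_nhds c)
  rw [← contMDiffAt_iff_contDiffAt]
  refine ContMDiffAt.comp (I' := 𝓘(ℝ, ℝ).prod (𝓡 m)) _ (by simpa using hF) ?_
  refine ContMDiffAt.prodMk ?_ ?_
  · exact contMDiffAt_iff_contDiffAt.2 contDiffAt_fst
  · exact h1.comp_of_eq (I' := 𝓘(ℝ, 𝔼)) (contMDiffAt_iff_contDiffAt.2 contDiffAt_snd) rfl

/-- The derivative in the space variable of a `C^1` map is locally bounded. -/
theorem eventually_norm_mfderiv_vector_le {F : ℝ × Y → 𝔼} {t₀ : ℝ} {c : Y}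
    (hF : ContMDiffAt (𝓘(ℝ, ℝ).prod (𝓡 m)) 𝓘(ℝ, 𝔼) 1 F (t₀, c)) :
    ∃ K : ℝ, 0 < K ∧ ∀ᶠ p : ℝ × Y in 𝓝 (t₀, c), ∀ v : TangentSpace (𝓡 m) p.2,
      ‖(id (mfderiv (𝓡 m) 𝓘(ℝ, 𝔼) (fun y => F (p.1, y)) p.2 v) : 𝔼)‖ ≤ K * ‖v‖ := by
  have hG := contDiffAt_comp_chart_symm hF
  set G : ℝ × 𝔼 → 𝔼 := fun p => F (p.1, (extChartAt (𝓡 m) c).symm p.2)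
  obtain ⟨C, hC, H⟩ := exists_chart_norm_bound (m := m) c
  have hd : ∀ᶠ p in 𝓝 (t₀, extChartAt (𝓡 m) c c), ContDiffAt ℝ 1 G p :=
    hG.eventually (by simp)
  have hb : ∀ᶠ p in 𝓝 (t₀, extChartAt (𝓡 m) c c),
      ‖fderiv ℝ G p‖ < ‖fderiv ℝ G (t₀, extChartAt (𝓡 m) c c)‖ + 1 :=
    (hG.continuousAt_fderiv one_ne_zero).norm.eventually_lt continuousAt_const (by simp)
  refine ⟨(‖fderiv ℝ G (t₀, extChartAt (𝓡 m) c c)‖ + 1) * C, by positivity, ?_⟩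
  have hcont : ContinuousAt (fun p : ℝ × Y => (p.1, extChartAt (𝓡 m) c p.2)) (t₀, c) :=
    continuousAt_fst.prodMk ((continuousAt_extChartAt c).comp_of_eq continuousAt_snd rfl)
  filter_upwards [hcont.eventually (hd.and hb), continuousAt_snd.eventually H] with p hp hp2 v
  obtain ⟨hp, hpb⟩ := hp
  obtain ⟨hs, hv⟩ := hp2
  have hχ : MDifferentiableAt (𝓡 m) 𝓘(ℝ, 𝔼) (extChartAt (𝓡 m) c) p.2 :=
    mdifferentiableAt_extChartAt hs
  have hGd : HasFDerivAt (fun z => G (p.1, z))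
      ((fderiv ℝ G (p.1, extChartAt (𝓡 m) c p.2)).comp (ContinuousLinearMap.inr ℝ ℝ 𝔼))
      (extChartAt (𝓡 m) c p.2) :=
    (hp.differentiableAt one_ne_zero).hasFDerivAt.comp (extChartAt (𝓡 m) c p.2)
      (hasFDerivAt_prodMk_right _ _)
  -- Near `p.2` the map factors as its expression `G` in the fixed chart at `c`, whose derivative is
  -- continuous, after that chart.
  have hcomp := hGd.hasMFDerivAt.comp p.2 hχ.hasMFDerivAt
  have heq : (fun y => F (p.1, y)) =ᶠ[𝓝 p.2] (fun z => G (p.1, z)) ∘ extChartAt (𝓡 m) c := by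
    filter_upwards [(chartAt 𝔼 c).open_source.mem_nhds hs] with y hy
    simp only [G, Function.comp]
    rw [(extChartAt (𝓡 m) c).left_inv (by simpa using hy)]
  rw [(hcomp.congr_of_eventuallyEq heq).mfderiv]
  set w : 𝔼 := id (mfderiv (𝓡 m) 𝓘(ℝ, 𝔼) (extChartAt (𝓡 m) c) p.2 v) with hw
  change ‖fderiv ℝ G (p.1, extChartAt (𝓡 m) c p.2) (0, w)‖ ≤ _
  calc _ ≤ ‖fderiv ℝ G (p.1, extChartAt (𝓡 m) c p.2)‖ * ‖((0 : ℝ), w)‖ :=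
        ContinuousLinearMap.le_opNorm _ _
    _ ≤ (‖fderiv ℝ G (t₀, extChartAt (𝓡 m) c c)‖ + 1) * (C * ‖v‖) := by
        gcongr
        have hvw : ‖w‖ ≤ C * ‖v‖ := (hv v).1
        rw [Prod.norm_mk, norm_zero, max_eq_right (norm_nonneg _)]
        exact hvw
    _ = _ := by ring

/-- A `C^1` map from a compact Riemannian manifold to a vector space is Lipschitz. -/
theorem exists_edist_vector_le [CompactSpace Y] {f : Y → 𝔼} (hf : ContMDiff (𝓡 m) 𝓘(ℝ, 𝔼) 1 f) :
    ∃ K : ℝ≥0, K ≠ 0 ∧ ∀ x y : Y, edist (f x) (f y) ≤ K * edist x y := by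
  obtain ⟨K, hK, H⟩ := (isCompact_univ (X := Y)).exists_bound_of_eventually
    (P := fun y K => ∀ v : TangentSpace (𝓡 m) y,
      ‖(id (mfderiv (𝓡 m) 𝓘(ℝ, 𝔼) f y v) : 𝔼)‖ ≤ K * ‖v‖)
    (fun x a b hab h v => (h v).trans (by gcongr)) (fun x _ => by
      obtain ⟨K, -, H⟩ := eventually_norm_mfderiv_vector_le (m := m) (Y := Y)
        (F := fun p => f p.2) (t₀ := 0) (c := x) ((hf x).comp_of_eq contMDiffAt_snd rfl)
      exact ⟨K, (Continuous.prodMk_right (0 : ℝ)).continuousAt.eventually H⟩)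
  exact ⟨⟨K, hK.le⟩, (show (0 : ℝ≥0) < ⟨K, hK.le⟩ from hK).ne',
    edist_le_of_norm_mfderiv_vector_le hf (show (0 : ℝ≥0) < ⟨K, hK.le⟩ from hK).ne' fun y v =>
      H y (mem_univ y) v⟩

/-- A bump function extends the chart to a global smooth map, so curves that leave the chart domain
cause no trouble. -/
theorem exists_edist_extChartAt_le [CompactSpace Y] (c : Y) : ∃ C : ℝ≥0, C ≠ 0 ∧
    ∀ᶠ p : Y × Y in 𝓝 (c, c), edist (extChartAt (𝓡 m) c p.1) (extChartAt (𝓡 m) c p.2) ≤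
      C * edist p.1 p.2 := by
  let ψ : SmoothBumpFunction (𝓡 m) c := Classical.arbitrary _
  have hf : ContMDiff (𝓡 m) 𝓘(ℝ, 𝔼) ∞ fun x => ψ x • extChartAt (𝓡 m) c x :=
    ψ.contMDiff_smul (contMDiffOn_extChartAt)
  obtain ⟨C, hC, H⟩ := exists_edist_vector_le (hf.of_le (by simp))
  refine ⟨C, hC, ?_⟩
  have h1 := ψ.eventuallyEq_one
  rw [nhds_prod_eq]
  filter_upwards [h1.prod_mk h1] with p hp
  have := H p.1 p.2
  simpa [hp.1, hp.2] using this

/-- The Euclidean segment between the images stays in a ball inside the chart target; its lift to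
`Y` is a competitor for the distance. -/
theorem exists_edist_le_edist_extChartAt (c : Y) : ∃ C : ℝ≥0, C ≠ 0 ∧
    ∀ᶠ p : Y × Y in 𝓝 (c, c),
      edist p.1 p.2 ≤ C * edist (extChartAt (𝓡 m) c p.1) (extChartAt (𝓡 m) c p.2) := by
  obtain ⟨C, hC, H⟩ := exists_chart_norm_bound (m := m) c
  lift C to ℝ≥0 using hC.le
  refine ⟨C, by simpa using hC.ne', ?_⟩
  have hsymm : ∀ᶠ z in 𝓝 (extChartAt (𝓡 m) c c), z ∈ (extChartAt (𝓡 m) c).target ∧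
      ((extChartAt (𝓡 m) c).symm z ∈ (chartAt 𝔼 c).source ∧
        ∀ v : TangentSpace (𝓡 m) ((extChartAt (𝓡 m) c).symm z),
          ‖v‖ ≤ C * ‖(id (mfderiv (𝓡 m) 𝓘(ℝ, 𝔼) (extChartAt (𝓡 m) c) _ v) : 𝔼)‖) := by
    have : ContinuousAt (extChartAt (𝓡 m) c).symm (extChartAt (𝓡 m) c c) :=
      continuousAt_extChartAt_symm c
    rw [ContinuousAt, extChartAt_to_inv] at this
    have h2 := this.eventually H
    filter_upwards [extChartAt_target_mem_nhds (I := 𝓡 m) c, h2] with z hz' hz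
    exact ⟨hz', hz.1, fun v => (hz.2 v).2⟩
  obtain ⟨r, hr, hball⟩ := Metric.eventually_nhds_iff_ball.1 hsymm
  have hm : ∀ᶠ y in 𝓝 c, y ∈ (chartAt 𝔼 c).source ∧
      extChartAt (𝓡 m) c y ∈ Metric.ball (extChartAt (𝓡 m) c c) r :=
    (eventually_mem_set.2 (chart_source_mem_nhds 𝔼 c)).and
      ((continuousAt_extChartAt c).eventually (Metric.ball_mem_nhds _ hr))
  rw [nhds_prod_eq]
  filter_upwards [hm.prod_mk hm] with p hp
  obtain ⟨⟨hs1, hb1⟩, hs2, hb2⟩ := hp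
  let η := ContinuousAffineMap.lineMap (R := ℝ) (extChartAt (𝓡 m) c p.1) (extChartAt (𝓡 m) c p.2)
  set γ := (extChartAt (𝓡 m) c).symm ∘ η
  have hη : ∀ t ∈ Icc (0 : ℝ) 1, η t ∈ Metric.ball (extChartAt (𝓡 m) c c) r := by
    intro t ht
    have : η '' Icc 0 1 ⊆ Metric.ball (extChartAt (𝓡 m) c c) r := by
      simp only [ContinuousAffineMap.coe_lineMap_eq, ← segment_eq_image_lineMap, η]
      exact (convex_ball _ _).segment_subset hb1 hb2
    exact this (mem_image_of_mem _ ht)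
  have η_smooth : ContMDiffOn 𝓘(ℝ, ℝ) 𝓘(ℝ, 𝔼) 1 η (Icc 0 1) :=
    (contMDiff_iff_contDiff.2 (ContinuousAffineMap.contDiff _)).contMDiffOn
  have hγ : ContMDiffOn 𝓘(ℝ, ℝ) (𝓡 m) 1 γ (Icc 0 1) :=
    (contMDiffOn_extChartAt_symm c).comp η_smooth fun t ht => (hball _ (hη t ht)).1
  rw [IsRiemannianManifold.out (I := 𝓡 m) p.1 p.2]
  have : riemannianEDist (𝓡 m) p.1 p.2 ≤ pathELength (𝓡 m) γ 0 1 := by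
    apply riemannianEDist_le_pathELength hγ _ _ zero_le_one
    · simp [γ, η, ContinuousAffineMap.coe_lineMap_eq, hs1]
    · simp [γ, η, ContinuousAffineMap.coe_lineMap_eq, hs2]
  refine this.trans ?_
  rw [← lintegral_fderiv_lineMap_eq_edist, pathELength_eq_lintegral_mfderivWithin_Icc,
    ← lintegral_const_mul' _ _ ENNReal.coe_ne_top]
  refine setLIntegral_mono' measurableSet_Icc fun t ht => ?_
  refine enorm_le_mul_enorm_of_norm_le (((hball _ (hη t ht)).2.2 _).trans_eq ?_)
  have hU : UniqueMDiffWithinAt 𝓘(ℝ, ℝ) (Icc (0 : ℝ) 1) t :=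
    (uniqueDiffOn_Icc zero_lt_one t ht).uniqueMDiffWithinAt
  have e := mfderiv_comp_mfderivWithin (I := 𝓘(ℝ, ℝ)) (I' := 𝓡 m) (I'' := 𝓘(ℝ, 𝔼))
    (g := extChartAt (𝓡 m) c) t
    (mdifferentiableAt_extChartAt (hball _ (hη t ht)).2.1)
    (hγ.mdifferentiableOn one_ne_zero t ht) hU
  have e2 : mfderivWithin 𝓘(ℝ, ℝ) 𝓘(ℝ, 𝔼) (extChartAt (𝓡 m) c ∘ γ) (Icc 0 1) t =
      fderivWithin ℝ η (Icc 0 1) t := by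
    rw [mfderivWithin_eq_fderivWithin]
    refine fderivWithin_congr (fun u hu => ?_) ?_
    · exact (extChartAt (𝓡 m) c).right_inv (hball _ (hη u hu)).1
    · exact (extChartAt (𝓡 m) c).right_inv (hball _ (hη t ht)).1
  rw [e] at e2
  congr 2
  exact DFunLike.congr_fun e2 1

/-! ### The derivative of the flow and the speed of its orbits. -/

/-- The derivative of the time `t` map of a flow, in the model space. -/
def flowDeriv (φ : Flow ℝ Y) (t : ℝ) (y : Y) : 𝔼 →L[ℝ] 𝔼 := mfderiv (𝓡 m) (𝓡 m) (φ t) y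

/-- The value of a vector field at `y`, as a vector of the model space. -/
def modelVector (V : ∀ y : Y, TangentSpace (𝓡 m) y) (y : Y) : 𝔼 := V y

/-- The Riemannian norm of a tangent vector at `y`, seen as a vector of the model space. -/
def tangentNorm (y : Y) (v : 𝔼) : ℝ := ‖(show TangentSpace (𝓡 m) y from v)‖

theorem tangentNorm_nonneg (y : Y) (v : 𝔼) : 0 ≤ tangentNorm y v :=
  norm_nonneg (show TangentSpace (𝓡 m) y from v)

theorem tangentNorm_add_le (y : Y) (v w : 𝔼) :
    tangentNorm y (v + w) ≤ tangentNorm y v + tangentNorm y w :=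
  norm_add_le (show TangentSpace (𝓡 m) y from v) (show TangentSpace (𝓡 m) y from w)

theorem tangentNorm_smul (y : Y) (a : ℝ) (v : 𝔼) :
    tangentNorm y (a • v) = |a| * tangentNorm y v :=
  norm_smul a (show TangentSpace (𝓡 m) y from v)

theorem tangentNorm_eq_zero {y : Y} {v : 𝔼} : tangentNorm y v = 0 ↔ v = 0 :=
  norm_eq_zero (a := (show TangentSpace (𝓡 m) y from v))

theorem IsFlowOf.contMDiff_time (hφ : IsFlowOf φ V) (t : ℝ) : ContMDiff (𝓡 m) (𝓡 m) ∞ (φ t) :=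
  hφ.smooth.comp (contMDiff_const.prodMk contMDiff_id)

theorem IsFlowOf.mdifferentiableAt (hφ : IsFlowOf φ V) (t : ℝ) (y : Y) :
    MDifferentiableAt (𝓡 m) (𝓡 m) (φ t) y :=
  (hφ.contMDiff_time t).mdifferentiableAt (by simp)

theorem IsFlowOf.flowDeriv_add (hφ : IsFlowOf φ V) (s t : ℝ) (y : Y) (v : 𝔼) :
    flowDeriv φ (s + t) y v = flowDeriv φ s (φ t y) (flowDeriv φ t y v) := by
  have : (φ (s + t) : Y → Y) = φ s ∘ φ t := by
    ext y; exact φ.map_add s t y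
  have := mfderiv_comp (I := 𝓡 m) (I' := 𝓡 m) (I'' := 𝓡 m) y (hφ.mdifferentiableAt s (φ t y))
    (hφ.mdifferentiableAt t y)
  unfold flowDeriv
  rw [‹(φ (s + t) : Y → Y) = φ s ∘ φ t›, this]
  rfl

theorem flowDeriv_zero (y : Y) (v : 𝔼) : flowDeriv φ 0 y v = v := by
  have : (φ 0 : Y → Y) = id := by
    ext y; exact φ.map_zero_apply y
  unfold flowDeriv
  rw [this, mfderiv_id]
  rfl

theorem IsFlowOf.contMDiffAt_chart (hφ : IsFlowOf φ V) {t : ℝ} {y q : Y}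
    (hq : φ t y ∈ (chartAt 𝔼 q).source) :
    ContMDiffAt (𝓘(ℝ, ℝ).prod (𝓡 m)) 𝓘(ℝ, 𝔼) 1
      (fun p : ℝ × Y => extChartAt (𝓡 m) q (φ p.1 p.2)) (t, y) :=
  (contMDiffAt_extChartAt' (by simpa using hq)).comp_of_eq ((hφ.smooth (t, y)).of_le (by simp)) rfl

/-- In charts, the flow is strictly differentiable jointly in time and space. -/
theorem IsFlowOf.hasStrictFDerivAt_chart (hφ : IsFlowOf φ V) (τ : ℝ) (p : Y) :
    ∃ A : ℝ × 𝔼 →L[ℝ] 𝔼,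
    HasStrictFDerivAt (fun z : ℝ × 𝔼 =>
      extChartAt (𝓡 m) (φ τ p) (φ z.1 ((extChartAt (𝓡 m) p).symm z.2))) A
      (τ, extChartAt (𝓡 m) p p) ∧
    ∀ (b : ℝ) (w : 𝔼), A (b, w) = flowDeriv φ τ p w + b • modelVector V (φ τ p) := by
  have hG := contDiffAt_comp_chart_symm
    (hφ.contMDiffAt_chart (t := τ) (y := p) (mem_chart_source 𝔼 (φ τ p)))
  have hs := hG.hasStrictFDerivAt one_ne_zero
  refine ⟨_, hs, ?_⟩
  generalize fderiv ℝ (fun z : ℝ × 𝔼 => extChartAt (𝓡 m) (φ τ p)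
    (φ z.1 ((extChartAt (𝓡 m) p).symm z.2))) (τ, extChartAt (𝓡 m) p p) = A at hs
  intro b w
  -- `A` is identified by its partial derivatives: in space it is the derivative of the time `τ`
  -- map, in time it is the vector field.
  have h1 : HasFDerivAt (fun z : 𝔼 => extChartAt (𝓡 m) (φ τ p) (φ τ ((extChartAt (𝓡 m) p).symm z)))
      (A.comp (ContinuousLinearMap.inr ℝ ℝ 𝔼)) (extChartAt (𝓡 m) p p) :=
    hs.hasFDerivAt.comp (extChartAt (𝓡 m) p p) (hasFDerivAt_prodMk_right _ _)
  have h2 : HasFDerivAt (fun z : 𝔼 => extChartAt (𝓡 m) (φ τ p) (φ τ ((extChartAt (𝓡 m) p).symm z)))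
      (flowDeriv φ τ p) (extChartAt (𝓡 m) p p) := by
    have : HasFDerivWithinAt
        (fun z : 𝔼 => extChartAt (𝓡 m) (φ τ p) (φ τ ((extChartAt (𝓡 m) p).symm z)))
        (flowDeriv φ τ p) (range (𝓡 m)) (extChartAt (𝓡 m) p p) :=
      (hφ.mdifferentiableAt τ p).hasMFDerivAt.2
    rwa [ModelWithCorners.range_eq_univ, hasFDerivWithinAt_univ] at this
  have h3 : HasFDerivAt (fun t : ℝ =>
      extChartAt (𝓡 m) (φ τ p) (φ t ((extChartAt (𝓡 m) p).symm (extChartAt (𝓡 m) p p))))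
      (A.comp (ContinuousLinearMap.inl ℝ ℝ 𝔼)) τ :=
    HasFDerivAt.comp (f := fun t : ℝ => (t, extChartAt (𝓡 m) p p)) τ hs.hasFDerivAt
      (hasFDerivAt_prodMk_left _ _)
  have h4 : HasFDerivAt (fun t : ℝ => extChartAt (𝓡 m) (φ τ p) (φ t p))
      ((1 : ℝ →L[ℝ] ℝ).smulRight (modelVector V (φ τ p))) τ := by
    have : HasFDerivWithinAt (fun t : ℝ => extChartAt (𝓡 m) (φ τ p) (φ t p))
      ((1 : ℝ →L[ℝ] ℝ).smulRight (modelVector V (φ τ p))) (range 𝓘(ℝ, ℝ)) τ :=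
      (hφ.integralCurve p τ).2
    rwa [ModelWithCorners.range_eq_univ, hasFDerivWithinAt_univ] at this
  rw [extChartAt_to_inv] at h3
  have e1 := DFunLike.congr_fun (h1.unique h2) w
  have e2 := DFunLike.congr_fun (h3.unique h4) b
  have : ((b, w) : ℝ × 𝔼) = (0, w) + (b, 0) := by simp
  rw [this, map_add]
  exact congrArg₂ (· + ·) e1 (e2.trans (by simp))

/-- The derivative of the flow preserves the generating vector field. -/
theorem IsFlowOf.flowDeriv_vectorField (hφ : IsFlowOf φ V) (t : ℝ) (y : Y) :
    flowDeriv φ t y (modelVector V y) = modelVector V (φ t y) := by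
  have h1 := (hφ.mdifferentiableAt t (φ 0 y)).hasMFDerivAt.comp (0 : ℝ) (hφ.integralCurve y 0)
  have h2 := (hφ.integralCurve y).comp_add t 0
  have e : (fun s => φ s y) ∘ (· + t) = φ t ∘ fun s => φ s y := by
    ext s
    simp only [Function.comp, ← φ.map_add, add_comm]
  rw [e] at h2
  have h3 : flowDeriv φ t (φ 0 y) (modelVector V (φ 0 y)) = modelVector V (φ t (φ 0 y)) := by
    have := DFunLike.congr_fun (hasMFDerivAt_unique h1 h2) (1 : ℝ)
    refine Eq.trans ?_ (this.trans (one_smul ℝ (modelVector V (φ t (φ 0 y)))))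
    exact congrArg (flowDeriv φ t (φ 0 y)) (one_smul ℝ (modelVector V (φ 0 y))).symm
  rwa [φ.map_zero_apply] at h3

theorem IsFlowOf.eventually_tangentNorm_flowDeriv_le (hφ : IsFlowOf φ V) (t₀ : ℝ) (c : Y) :
    ∃ K : ℝ, ∀ᶠ p : ℝ × Y in 𝓝 (t₀, c), ∀ v : 𝔼,
      tangentNorm (φ p.1 p.2) (flowDeriv φ p.1 p.2 v) ≤ K * tangentNorm p.2 v := by
  obtain ⟨K, hK, H⟩ := eventually_norm_mfderiv_vector_le
    (hφ.contMDiffAt_chart (t := t₀) (y := c) (mem_chart_source 𝔼 (φ t₀ c)))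
  obtain ⟨C, hC, H'⟩ := exists_chart_norm_bound (m := m) (φ t₀ c)
  have hc : Continuous fun p : ℝ × Y => φ p.1 p.2 := hφ.smooth.continuous
  refine ⟨C * K, ?_⟩
  filter_upwards [H, (hc.tendsto (t₀, c)).eventually H'] with p hp hp' v
  have e := mfderiv_comp (I := 𝓡 m) (I' := 𝓡 m) (I'' := 𝓘(ℝ, 𝔼)) p.2
    (g := extChartAt (𝓡 m) (φ t₀ c)) (mdifferentiableAt_extChartAt hp'.1)
    (hφ.mdifferentiableAt p.1 p.2)
  refine ((hp'.2 (mfderiv (𝓡 m) (𝓡 m) (φ p.1) p.2 v)).2).trans ?_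
  rw [mul_assoc]
  refine mul_le_mul_of_nonneg_left ?_ hC.le
  refine le_trans (le_of_eq ?_) (hp v)
  exact congrArg norm (DFunLike.congr_fun e v).symm

theorem IsFlowOf.exists_tangentNorm_flowDeriv_le [CompactSpace Y] (hφ : IsFlowOf φ V) (N : ℝ) :
    ∃ K : ℝ, 0 < K ∧ ∀ t, |t| ≤ N → ∀ (y : Y) (v : 𝔼),
      tangentNorm (φ t y) (flowDeriv φ t y v) ≤ K * tangentNorm y v := by
  obtain ⟨K, hK, H⟩ := ((isCompact_Icc (a := -N) (b := N)).prod
    (isCompact_univ (X := Y))).exists_bound_of_eventually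
    (P := fun p K => ∀ v : 𝔼,
      tangentNorm (φ p.1 p.2) (flowDeriv φ p.1 p.2 v) ≤ K * tangentNorm p.2 v)
    (fun x a b hab h v => (h v).trans (by have := tangentNorm_nonneg x.2 v; gcongr))
    (fun p _ => hφ.eventually_tangentNorm_flowDeriv_le p.1 p.2)
  exact ⟨K, hK, fun t ht y v => H (t, y) ⟨abs_le.1 ht, mem_univ _⟩ v⟩

theorem IsFlowOf.edist_le_of_tangentNorm_le (hφ : IsFlowOf φ V) {t K : ℝ} (hK : 0 < K)
    (h : ∀ (y : Y) (v : 𝔼), tangentNorm (φ t y) (flowDeriv φ t y v) ≤ K * tangentNorm y v)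
    (x y : Y) : edist (φ t x) (φ t y) ≤ ENNReal.ofReal K * edist x y := by
  refine edist_map_le_of_norm_mfderiv_le ((hφ.contMDiff_time t).of_le (by simp))
    (K := K.toNNReal) (by simpa using hK) (fun y v => ?_) x y
  rw [Real.coe_toNNReal _ hK.le]
  exact h y v

theorem IsFlowOf.exists_lipschitz [CompactSpace Y] (hφ : IsFlowOf φ V) (N : ℝ) :
    ∃ K : ℝ, 0 < K ∧ ∀ t, |t| ≤ N → ∀ x y : Y,
      edist (φ t x) (φ t y) ≤ ENNReal.ofReal K * edist x y := by
  obtain ⟨K, hK, H⟩ := hφ.exists_tangentNorm_flowDeriv_le N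
  exact ⟨K, hK, fun t ht => hφ.edist_le_of_tangentNorm_le hK (H t ht)⟩

/-- The flow of a nowhere vanishing vector field moves points at a speed which is bounded, and
bounded away from zero. -/
theorem IsFlowOf.exists_edist_time [CompactSpace Y] (hφ : IsFlowOf φ V) (hV : ∀ y, V y ≠ 0) :
    ∃ K : ℝ, 0 < K ∧ ∀ (x : Y) (β : ℝ), |β| ≤ K⁻¹ →
      ENNReal.ofReal (K⁻¹ * |β|) ≤ edist (φ β x) x ∧
      edist (φ β x) x ≤ ENNReal.ofReal (K * |β|) := by
  suffices h : ∃ K : ℝ, 0 < K ∧ ∀ x ∈ (univ : Set Y), 0 < K ∧ ∀ β : ℝ, |β| ≤ K⁻¹ →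
      ENNReal.ofReal (K⁻¹ * |β|) ≤ edist (φ β x) x ∧
      edist (φ β x) x ≤ ENNReal.ofReal (K * |β|) by
    obtain ⟨K, hK, H⟩ := h
    exact ⟨K, hK, fun x => (H x (mem_univ x)).2⟩
  refine (isCompact_univ (X := Y)).exists_bound_of_eventually
    (P := fun x K => 0 < K ∧ ∀ β : ℝ, |β| ≤ K⁻¹ →
      ENNReal.ofReal (K⁻¹ * |β|) ≤ edist (φ β x) x ∧
      edist (φ β x) x ≤ ENNReal.ofReal (K * |β|)) ?_ ?_
  · rintro x a b hab ⟨ha, h⟩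
    refine ⟨ha.trans_le hab, fun β hβ => ?_⟩
    have hi : b⁻¹ ≤ a⁻¹ := inv_anti₀ ha hab
    obtain ⟨h1, h2⟩ := h β (hβ.trans hi)
    exact ⟨(by gcongr : ENNReal.ofReal (b⁻¹ * |β|) ≤ ENNReal.ofReal (a⁻¹ * |β|)).trans h1,
      h2.trans (by gcongr)⟩
  · intro c _
    obtain ⟨A, hA, hAv⟩ := hφ.hasStrictFDerivAt_chart 0 c
    simp only [φ.map_zero_apply] at hA hAv
    obtain ⟨C₁, hC₁, H₁⟩ := exists_edist_extChartAt_le (m := m) c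
    obtain ⟨C₂, hC₂, H₂⟩ := exists_edist_le_edist_extChartAt (m := m) c
    have hv : 0 < ‖modelVector V c‖ := norm_pos_iff.2 (hV c)
    set v := ‖modelVector V c‖ with hvdef
    have hχ : ContinuousAt (extChartAt (𝓡 m) c) c := continuousAt_extChartAt c
    -- Strict differentiability makes the estimate uniform in the base point near `c`: moving by
    -- time `β` displaces the chart image by `β V(c)` up to an error `|β| ‖V(c)‖ / 2`.
    have hs := (hA.isLittleO.def (half_pos hv))
    have hc : Continuous fun p : ℝ × Y => φ p.1 p.2 := hφ.smooth.continuous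
    have t1 : Tendsto (fun p : ℝ × Y => (((p.1, extChartAt (𝓡 m) c p.2) : ℝ × 𝔼),
        ((0, extChartAt (𝓡 m) c p.2) : ℝ × 𝔼))) (𝓝 (0, c))
        (𝓝 ((0, extChartAt (𝓡 m) c c), (0, extChartAt (𝓡 m) c c))) := by
      have h2 : ContinuousAt (fun p : ℝ × Y => extChartAt (𝓡 m) c p.2) (0, c) :=
        hχ.comp_of_eq continuousAt_snd rfl
      exact (continuousAt_fst.prodMk h2).prodMk (continuousAt_const.prodMk h2)
    have t2 : Tendsto (fun p : ℝ × Y => (φ p.1 p.2, p.2)) (𝓝 (0, c)) (𝓝 (c, c)) := by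
      have := (hc.prodMk continuous_snd).tendsto ((0, c) : ℝ × Y)
      simpa using this
    have hev := ((t1.eventually hs).and ((t2.eventually H₁).and (t2.eventually H₂))).and
      (continuousAt_snd.eventually (chart_source_mem_nhds 𝔼 c))
    rw [nhds_prod_eq] at hev
    obtain ⟨pa, ha, pb, hb, hab⟩ := eventually_prod_iff.1 hev
    obtain ⟨r, hr, har⟩ := Metric.eventually_nhds_iff.1 ha
    refine ⟨max (2 / r) (max (C₁ * (2 / v)) (C₂ * (2 * v))), ?_⟩
    set K := max (2 / r) (max (C₁ * (2 / v)) (C₂ * (2 * v))) with hKdef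
    have hK : 0 < K := lt_max_of_lt_left (by positivity)
    filter_upwards [hb] with x hx
    refine ⟨hK, fun β hβ => ?_⟩
    have hβr : |β| < r := by
      have : K⁻¹ ≤ (2 / r)⁻¹ := inv_anti₀ (by positivity) (le_max_left _ _)
      rw [inv_div] at this
      linarith
    obtain ⟨⟨h1, h2, h3⟩, h4⟩ := hab (har (by simpa using hβr)) hx
    have e0 : ((β, extChartAt (𝓡 m) c x) : ℝ × 𝔼) - (0, extChartAt (𝓡 m) c x) = (β, 0) := by simp
    simp only [e0, hAv, map_zero, zero_add, (extChartAt (𝓡 m) c).left_inv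
      (by rw [extChartAt_source]; exact h4 : x ∈ (extChartAt (𝓡 m) c).source),
      φ.map_zero_apply, Prod.norm_mk, norm_zero, max_eq_left (norm_nonneg β)] at h1
    have hn : ‖β • modelVector V c‖ = |β| * v := norm_smul β _
    rw [Real.norm_eq_abs] at h1
    set d := ‖extChartAt (𝓡 m) c (φ β x) - extChartAt (𝓡 m) c x‖ with hd
    have hlow : v / 2 * |β| ≤ d := by
      have := norm_sub_norm_le (β • modelVector V c)
        (extChartAt (𝓡 m) c (φ β x) - extChartAt (𝓡 m) c x)
      rw [norm_sub_rev (β • modelVector V c), hn] at this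
      linarith
    have hup : d ≤ 2 * v * |β| := by
      have := norm_sub_norm_le (extChartAt (𝓡 m) c (φ β x) - extChartAt (𝓡 m) c x)
        (β • modelVector V c)
      rw [hn] at this
      nlinarith [abs_nonneg β]
    have hed : edist (extChartAt (𝓡 m) c (φ β x)) (extChartAt (𝓡 m) c x) = ENNReal.ofReal d := by
      rw [edist_dist, dist_eq_norm]
    simp only [hed] at h2 h3
    constructor
    · refine le_trans ?_ (ENNReal.div_le_of_le_mul' h2)
      have hC : (0 : ℝ) < C₁ := by positivity
      rw [← ENNReal.ofReal_coe_nnreal, ← ENNReal.ofReal_div_of_pos hC]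
      refine ENNReal.ofReal_le_ofReal ?_
      have : (C₁ : ℝ) * (2 / v) ≤ K := (le_max_left _ _).trans (le_max_right _ _)
      calc K⁻¹ * |β| ≤ (C₁ * (2 / v))⁻¹ * |β| := by gcongr
        _ = v / 2 * |β| / C₁ := by field_simp
        _ ≤ d / C₁ := by gcongr
    · refine h3.trans ?_
      rw [← ENNReal.ofReal_coe_nnreal, ← ENNReal.ofReal_mul (by positivity)]
      refine ENNReal.ofReal_le_ofReal ?_
      have : (C₂ : ℝ) * (2 * v) ≤ K := (le_max_right _ _).trans (le_max_right _ _)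
      calc (C₂ : ℝ) * d ≤ C₂ * (2 * v * |β|) := by gcongr
        _ = C₂ * (2 * v) * |β| := by ring
        _ ≤ K * |β| := by gcongr

theorem exists_tangentNorm_modelVector_bound [CompactSpace Y]
    (hVs : ContMDiff (𝓡 m) (𝓡 m).tangent ∞ (toSection V)) (hV : ∀ y, V y ≠ 0) :
    ∃ K : ℝ, 0 < K ∧ ∀ y, K⁻¹ ≤ tangentNorm y (modelVector V y) ∧
      tangentNorm y (modelVector V y) ≤ K := by
  have := isContinuousRiemannianBundle_tangentSpace (m := m) (Y := Y)
  have hc : Continuous fun y => inner ℝ (V y) (V y) :=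
    Continuous.inner_bundle (F := 𝔼) (E := fun y : Y => TangentSpace (𝓡 m) y) (b := fun y => y)
      hVs.continuous hVs.continuous
  have hc' : Continuous fun y => tangentNorm y (modelVector V y) := by
    have : (fun y => tangentNorm y (modelVector V y)) = fun y => √(inner ℝ (V y) (V y)) := by
      ext y
      exact norm_eq_sqrt_real_inner (V y)
    rw [this]
    exact hc.sqrt
  have hpos : ∀ y, 0 < tangentNorm y (modelVector V y) := fun y => norm_pos_iff.2 (hV y)
  obtain ⟨K, hK, H⟩ := (isCompact_univ (X := Y)).exists_bound_of_eventually
    (P := fun y K => 0 < K ∧ K⁻¹ ≤ tangentNorm y (modelVector V y) ∧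
      tangentNorm y (modelVector V y) ≤ K) (fun y a b hab ⟨h0, h1, h2⟩ =>
        ⟨h0.trans_le hab, (inv_anti₀ h0 hab).trans h1, h2.trans hab⟩) (fun y _ => by
    refine ⟨max (2 * tangentNorm y (modelVector V y)) (2 / tangentNorm y (modelVector V y)), ?_⟩
    have h0 := hpos y
    filter_upwards [(hc'.tendsto y).eventually_lt_const
        (show tangentNorm y (modelVector V y) < 2 * tangentNorm y (modelVector V y) by linarith),
      (hc'.tendsto y).eventually_const_lt
        (show tangentNorm y (modelVector V y) / 2 < tangentNorm y (modelVector V y) by linarith)]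
      with z h1 h2
    have h3 : (max (2 * tangentNorm y (modelVector V y)) (2 / tangentNorm y (modelVector V y)))⁻¹
        ≤ (2 / tangentNorm y (modelVector V y))⁻¹ :=
      inv_anti₀ (by positivity) (le_max_right _ _)
    rw [inv_div] at h3
    exact ⟨lt_max_of_lt_left (by positivity), h3.trans h2.le, h1.le.trans (le_max_left _ _)⟩)
  exact ⟨K, hK, fun y => (H y (mem_univ y)).2⟩

/-! ### Infinitesimal displacements. -/

/-- Strict differentiability is what allows both points to move while the rescaled difference passes
to the limit. -/
theorem _root_.HasStrictFDerivAt.tendsto_smul_sub {E F ι : Type*} [NormedAddCommGroup E]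
    [NormedSpace ℝ E] [NormedAddCommGroup F] [NormedSpace ℝ F] {f : E → F} {A : E →L[ℝ] F} {a : E}
    (hf : HasStrictFDerivAt f A a) {l : Filter ι} {x x' : ι → E} (hx : Tendsto x l (𝓝 a))
    (hx' : Tendsto x' l (𝓝 a)) {M : ι → ℝ} {w : E}
    (hw : Tendsto (fun j => M j • (x' j - x j)) l (𝓝 w)) :
    Tendsto (fun j => M j • (f (x' j) - f (x j))) l (𝓝 (A w)) := by
  have h1 : (fun j => f (x' j) - f (x j) - A (x' j - x j)) =o[l] fun j => x' j - x j :=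
    hf.isLittleO.comp_tendsto (hx'.prodMk_nhds hx)
  have h2 : (fun j => M j • (f (x' j) - f (x j) - A (x' j - x j))) =o[l]
      fun j => M j • (x' j - x j) := (Asymptotics.isBigO_refl M l).smul_isLittleO h1
  have h3 : Tendsto (fun j => M j • (f (x' j) - f (x j) - A (x' j - x j))) l (𝓝 0) :=
    (Asymptotics.isLittleO_one_iff ℝ).1 (h2.trans_isBigO (hw.isBigO_one ℝ))
  have h4 := h3.add ((A.continuous.tendsto w).comp hw)
  rw [zero_add] at h4
  refine h4.congr fun j => ?_
  simp only [Function.comp, map_smul, ← smul_add, sub_add_cancel]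

/-- The norm of an infinitesimal displacement is controlled by the distance. -/
theorem exists_tangentNorm_le_of_tendsto [CompactSpace Y] : ∃ C : ℝ, 0 < C ∧
    ∀ (q : Y) (u u' : ℕ → Y) (M : ℕ → ℝ) (R : ℝ) (v : 𝔼), 0 ≤ R →
      Tendsto u atTop (𝓝 q) → Tendsto u' atTop (𝓝 q) → (∀ j, 0 < M j) →
      (∀ᶠ j in atTop, edist (u' j) (u j) ≤ ENNReal.ofReal (R * M j)) →
      Tendsto (fun j => (M j)⁻¹ • (extChartAt (𝓡 m) q (u' j) - extChartAt (𝓡 m) q (u j))) atTop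
        (𝓝 v) → tangentNorm q v ≤ C * R := by
  suffices h : ∃ C : ℝ, 0 < C ∧ ∀ q ∈ (univ : Set Y),
    ∀ (u u' : ℕ → Y) (M : ℕ → ℝ) (R : ℝ) (v : 𝔼), 0 ≤ R →
      Tendsto u atTop (𝓝 q) → Tendsto u' atTop (𝓝 q) → (∀ j, 0 < M j) →
      (∀ᶠ j in atTop, edist (u' j) (u j) ≤ ENNReal.ofReal (R * M j)) →
      Tendsto (fun j => (M j)⁻¹ • (extChartAt (𝓡 m) q (u' j) - extChartAt (𝓡 m) q (u j))) atTop
        (𝓝 v) → tangentNorm q v ≤ C * R by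
    obtain ⟨C, hC, h⟩ := h
    exact ⟨C, hC, fun q => h q (mem_univ q)⟩
  refine (isCompact_univ (X := Y)).exists_bound_of_eventually (P := fun q C =>
    ∀ (u u' : ℕ → Y) (M : ℕ → ℝ) (R : ℝ) (v : 𝔼), 0 ≤ R →
      Tendsto u atTop (𝓝 q) → Tendsto u' atTop (𝓝 q) → (∀ j, 0 < M j) →
      (∀ᶠ j in atTop, edist (u' j) (u j) ≤ ENNReal.ofReal (R * M j)) →
      Tendsto (fun j => (M j)⁻¹ • (extChartAt (𝓡 m) q (u' j) - extChartAt (𝓡 m) q (u j))) atTop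
        (𝓝 v) → tangentNorm q v ≤ C * R)
    (fun q a b hab h u u' M R v hR h1 h2 h3 h4 h5 => (h u u' M R v hR h1 h2 h3 h4 h5).trans
      (by gcongr)) fun c _ => ?_
  obtain ⟨C₁, hC₁, H₁⟩ := exists_edist_extChartAt_le (m := m) c
  obtain ⟨C₂, hC₂, H₂⟩ := exists_chart_norm_bound (m := m) c
  refine ⟨C₂ * C₁, ?_⟩
  have H₁' : ∀ᶠ q in 𝓝 c, ∀ᶠ p : Y × Y in 𝓝 (q, q),
      edist (extChartAt (𝓡 m) c p.1) (extChartAt (𝓡 m) c p.2) ≤ C₁ * edist p.1 p.2 :=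
    ((continuous_id.prodMk continuous_id).tendsto c).eventually H₁.eventually_nhds
  filter_upwards [H₁', H₂] with q hq hq' u u' M R v hR hu hu' hM hd hv
  -- The preferred chart at `q` varies with `q` without control. Passing to the fixed chart at `c`
  -- makes the constant uniform for `q` near `c`.
  have hs : HasStrictFDerivAt (fun z => extChartAt (𝓡 m) c ((extChartAt (𝓡 m) q).symm z))
      (id (mfderiv (𝓡 m) 𝓘(ℝ, 𝔼) (extChartAt (𝓡 m) c) q) : 𝔼 →L[ℝ] 𝔼)
      (extChartAt (𝓡 m) q q) := by
    have hq1 : ContMDiffAt (𝓡 m) 𝓘(ℝ, 𝔼) 1 (extChartAt (𝓡 m) c) q :=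
      contMDiffAt_extChartAt' (by simpa using hq'.1)
    have hG := contDiffAt_comp_chart_symm (m := m) (F := fun p => extChartAt (𝓡 m) c p.2) (t₀ := 0)
      (c := q) (hq1.comp_of_eq contMDiffAt_snd rfl)
    have hG' : ContDiffAt ℝ 1 (fun z => extChartAt (𝓡 m) c ((extChartAt (𝓡 m) q).symm z))
        (extChartAt (𝓡 m) q q) :=
      hG.comp (f := fun z : 𝔼 => ((0 : ℝ), z)) _ (contDiffAt_const.prodMk contDiffAt_id)
    have h1 : HasFDerivWithinAt (fun z => extChartAt (𝓡 m) c ((extChartAt (𝓡 m) q).symm z))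
        (id (mfderiv (𝓡 m) 𝓘(ℝ, 𝔼) (extChartAt (𝓡 m) c) q) : 𝔼 →L[ℝ] 𝔼) (range (𝓡 m))
        (extChartAt (𝓡 m) q q) := (hq1.mdifferentiableAt one_ne_zero).hasMFDerivAt.2
    rw [ModelWithCorners.range_eq_univ, hasFDerivWithinAt_univ] at h1
    have h2 := hG'.hasStrictFDerivAt one_ne_zero
    rwa [h1.fderiv] at h2
  have hχ : ∀ {w : ℕ → Y}, Tendsto w atTop (𝓝 q) → Tendsto (fun j => extChartAt (𝓡 m) q (w j))
      atTop (𝓝 (extChartAt (𝓡 m) q q)) := fun hw => (continuousAt_extChartAt q).tendsto.comp hw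
  have hlim := (hs.tendsto_smul_sub (hχ hu) (hχ hu') hv).norm
  have hsource : ∀ᶠ y in 𝓝 q, y ∈ (extChartAt (𝓡 m) q).source := extChartAt_source_mem_nhds q
  have hle : ∀ᶠ j in atTop, ‖(M j)⁻¹ •
      (extChartAt (𝓡 m) c ((extChartAt (𝓡 m) q).symm (extChartAt (𝓡 m) q (u' j))) -
      extChartAt (𝓡 m) c ((extChartAt (𝓡 m) q).symm (extChartAt (𝓡 m) q (u j))))‖ ≤ C₁ * R := by
    filter_upwards [hd, hu.eventually hsource, hu'.eventually hsource,
      (hu'.prodMk_nhds hu).eventually hq] with j h1 h2 h3 h4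
    rw [(extChartAt (𝓡 m) q).left_inv h2, (extChartAt (𝓡 m) q).left_inv h3, norm_smul,
      ← dist_eq_norm, norm_inv, Real.norm_of_nonneg (hM j).le, inv_mul_le_iff₀ (hM j)]
    have := h4.trans (mul_le_mul_right h1 _)
    rw [edist_dist, ← ENNReal.ofReal_coe_nnreal, ← ENNReal.ofReal_mul (by positivity),
      ENNReal.ofReal_le_ofReal_iff (by have := hM j; positivity)] at this
    linarith
  have := le_of_tendsto hlim hle
  calc tangentNorm q v ≤ C₂ * _ := (hq'.2 v).2
    _ ≤ C₂ * (C₁ * R) := mul_le_mul_of_nonneg_left this hC₂.le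
    _ = _ := by ring

/-! ### Hyperbolicity: bounded tangent vectors are tangent to the flow. -/

/-- With all tangent vectors read in the model space, the stable and unstable families have the same
shape, and one lemma with a sign `σ = ±1` treats both. -/
theorem IsAnosov.exists_splitting (hA : IsAnosov φ V) : ∃ (Eu Es : Y → Set 𝔼) (C c : ℝ),
    0 < C ∧ 0 < c ∧
    (∀ y w, ∃ (a : ℝ) (u s : 𝔼), u ∈ Eu y ∧ s ∈ Es y ∧ w = a • modelVector V y + u + s) ∧
    (∀ t y, ∀ u ∈ Eu y, flowDeriv φ t y u ∈ Eu (φ t y)) ∧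
    (∀ t y, ∀ s ∈ Es y, flowDeriv φ t y s ∈ Es (φ t y)) ∧
    (∀ t y, 0 < t → ∀ s ∈ Es y,
      tangentNorm (φ t y) (flowDeriv φ t y s) ≤ C * Real.exp (-c * t) * tangentNorm y s) ∧
    (∀ t y, 0 < t → ∀ u ∈ Eu y,
      tangentNorm (φ (-t) y) (flowDeriv φ (-t) y u) ≤
        C * Real.exp (-c * t) * tangentNorm y u) := by
  obtain ⟨-, Eu, Es, hint, -, -, hu, hs, C, c, hC, hc, h⟩ := hA
  refine ⟨fun y => {v | (show TangentSpace (𝓡 m) y from v) ∈ Eu y},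
    fun y => {v | (show TangentSpace (𝓡 m) y from v) ∈ Es y}, C, c, hC, hc, fun y w => ?_, fun t y u h' => ?_,
    fun t y u h' => ?_, fun t y ht => (h t ht y).1, fun t y ht => (h t ht y).2⟩
  · have h1 : ⨆ i, (![Submodule.span ℝ {V y}, Eu y, Es y]) i ≤
        Submodule.span ℝ {V y} ⊔ (Eu y ⊔ Es y) := by
      refine iSup_le fun i => ?_
      fin_cases i
      · exact le_sup_left
      · exact le_sup_left.trans le_sup_right
      · exact le_sup_right.trans le_sup_right
    rw [(hint y).submodule_iSup_eq_top] at h1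
    have h2 : (show TangentSpace (𝓡 m) y from w) ∈ Submodule.span ℝ {V y} ⊔ (Eu y ⊔ Es y) :=
      h1 Submodule.mem_top
    obtain ⟨v, hv, z, hz, e⟩ := Submodule.mem_sup.1 h2
    obtain ⟨u, hu, s, hs, e'⟩ := Submodule.mem_sup.1 hz
    obtain ⟨a, ha⟩ := Submodule.mem_span_singleton.1 hv
    refine ⟨a, u, s, hu, hs, ?_⟩
    rw [← e', ← ha, ← add_assoc] at e
    exact e.symm
  · change (show TangentSpace (𝓡 m) (φ t y) from _) ∈ Eu (φ t y)
    rw [← hu t y]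
    exact Submodule.mem_map_of_mem h'
  · change (show TangentSpace (𝓡 m) (φ t y) from _) ∈ Es (φ t y)
    rw [← hs t y]
    exact Submodule.mem_map_of_mem h'

/-- A vector which is contracted exponentially in one time direction and whose orbit in the other
time direction is bounded modulo the direction of the flow is zero. -/
theorem IsFlowOf.eq_zero_of_contracted [CompactSpace Y] (hφ : IsFlowOf φ V)
    (hVs : ContMDiff (𝓡 m) (𝓡 m).tangent ∞ (toSection V)) (hV : ∀ y, V y ≠ 0)
    {F : Y → Set 𝔼} {C c σ : ℝ} (hC : 0 < C) (hc : 0 < c) (hσ : |σ| = 1)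
    (hinv : ∀ t y, ∀ u ∈ F y, flowDeriv φ t y u ∈ F (φ t y))
    (hF : ∀ t y, 0 < t → ∀ u ∈ F y, tangentNorm (φ (-(σ * t)) y) (flowDeriv φ (-(σ * t)) y u) ≤
      C * Real.exp (-c * t) * tangentNorm y u)
    {a : Y} {u : 𝔼} (hu : u ∈ F a) {B : ℝ}
    (hB : ∀ t, 0 < t → ∃ b : ℝ, tangentNorm (φ (σ * t) a)
      (flowDeriv φ (σ * t) a u + b • modelVector V (φ (σ * t) a)) ≤ B) : u = 0 := by
  obtain ⟨K, hK, hKV⟩ := exists_tangentNorm_modelVector_bound (m := m) hVs hV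
  have hlim : Tendsto (fun t : ℝ => Real.exp (-c * t)) atTop (𝓝 0) := by
    refine Real.tendsto_exp_atBot.comp ?_
    exact tendsto_id.const_mul_atTop_of_neg (by linarith)
  -- The factor `K ^ 2` is the loss in passing from `‖b V‖` at one point to `‖b V‖` at another; `1 /
  -- 2` allows absorption.
  obtain ⟨t₀, ht₀, ht₀'⟩ : ∃ t₀ : ℝ, 0 < t₀ ∧ K ^ 2 * (C * Real.exp (-c * t₀)) ≤ 1 / 2 := by
    have h1 : Tendsto (fun t : ℝ => K ^ 2 * (C * Real.exp (-c * t))) atTop (𝓝 0) := by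
      simpa using (hlim.const_mul C).const_mul (K ^ 2)
    obtain ⟨t, h, h'⟩ := ((h1.eventually_lt_const (show (0 : ℝ) < 1 / 2 by norm_num)).and
      (eventually_gt_atTop 0)).exists
    exact ⟨t, h', h.le⟩
  obtain ⟨L, hL, hLd⟩ := hφ.exists_tangentNorm_flowDeriv_le t₀
  -- A uniform angle between `F` and `V`, obtained dynamically: flowing for time `-σ t₀` nearly
  -- kills `v` but preserves `V`, so a bound on `v + b V` bounds `b`, and then `v` once half of its
  -- norm is absorbed.
  have angle : ∀ (y : Y) (v : 𝔼) (b : ℝ), v ∈ F y →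
      tangentNorm y (v + b • modelVector V y) ≤ B → tangentNorm y v ≤ 2 * (1 + K ^ 2 * L) * B := by
    intro y v b hv hb
    have hB0 : 0 ≤ B := (tangentNorm_nonneg _ _).trans hb
    set r := -(σ * t₀)
    have h1 := hLd r (by simp [r, abs_mul, hσ, abs_of_pos ht₀]) y (v + b • modelVector V y)
    rw [map_add, map_smul, hφ.flowDeriv_vectorField] at h1
    have h2 := hF t₀ y ht₀ v hv
    have h3 : tangentNorm (φ r y) (b • modelVector V (φ r y)) ≤
        tangentNorm (φ r y) (flowDeriv φ r y v + b • modelVector V (φ r y)) +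
          tangentNorm (φ r y) (flowDeriv φ r y v) := by
      have := tangentNorm_add_le (φ r y) (flowDeriv φ r y v + b • modelVector V (φ r y))
        ((-1 : ℝ) • flowDeriv φ r y v)
      rw [tangentNorm_smul] at this
      simpa using this
    rw [tangentNorm_smul] at h3
    have h4 : tangentNorm y v ≤ B + |b| * K := by
      have := tangentNorm_add_le y (v + b • modelVector V y) ((-b) • modelVector V y)
      rw [tangentNorm_smul, abs_neg] at this
      have e : v + b • modelVector V y + (-b) • modelVector V y = v := by simp
      rw [e] at this
      exact this.trans (add_le_add hb (mul_le_mul_of_nonneg_left (hKV y).2 (abs_nonneg b)))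
    have h5 : |b| * K⁻¹ ≤ L * B + C * Real.exp (-c * t₀) * tangentNorm y v := by
      refine (mul_le_mul_of_nonneg_left (hKV (φ r y)).1 (abs_nonneg b)).trans (h3.trans ?_)
      exact add_le_add (h1.trans (mul_le_mul_of_nonneg_left hb hL.le)) h2
    have h6 : |b| * K ≤ K ^ 2 * (L * B) + 1 / 2 * tangentNorm y v := by
      calc |b| * K = K ^ 2 * (|b| * K⁻¹) := by field_simp
        _ ≤ K ^ 2 * (L * B + C * Real.exp (-c * t₀) * tangentNorm y v) := by gcongr
        _ = K ^ 2 * (L * B) + K ^ 2 * (C * Real.exp (-c * t₀)) * tangentNorm y v := by ring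
        _ ≤ _ := by have := tangentNorm_nonneg y v; gcongr
    linarith
  -- The vector at time `σ t` is bounded uniformly in `t`; contracting it back to time 0 makes `u`
  -- exponentially small.
  have hbound : ∀ t, 0 < t →
      tangentNorm a u ≤ C * Real.exp (-c * t) * (2 * (1 + K ^ 2 * L) * B) := by
    intro t ht
    obtain ⟨b, hb⟩ := hB t ht
    have h1 := angle _ _ b (hinv (σ * t) a u hu) hb
    have h2 := hF t _ ht _ (hinv (σ * t) a u hu)
    rw [← hφ.flowDeriv_add, ← φ.map_add, neg_add_cancel, flowDeriv_zero, φ.map_zero_apply] at h2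
    exact h2.trans (by gcongr)
  have h0 : Tendsto (fun t : ℝ => C * Real.exp (-c * t) * (2 * (1 + K ^ 2 * L) * B)) atTop
      (𝓝 0) := by
    simpa using (hlim.const_mul C).mul_const (2 * (1 + K ^ 2 * L) * B)
  have := ge_of_tendsto h0 ((eventually_gt_atTop 0).mono hbound)
  exact tangentNorm_eq_zero.1 (le_antisymm this (tangentNorm_nonneg a u))

/-- For an Anosov flow, a tangent vector whose orbit is bounded modulo the direction of the flow is
tangent to the flow. -/
theorem IsAnosov.exists_eq_smul_of_bounded [CompactSpace Y] (hφ : IsFlowOf φ V) (hA : IsAnosov φ V)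
    (hVs : ContMDiff (𝓡 m) (𝓡 m).tangent ∞ (toSection V)) {a : Y} {w : 𝔼} {B : ℝ}
    (hB : ∀ t, ∃ b : ℝ, tangentNorm (φ t a) (flowDeriv φ t a w + b • modelVector V (φ t a)) ≤ B) :
    ∃ b : ℝ, w = b • modelVector V a := by
  have hV := hA.1
  obtain ⟨Eu, Es, C, c, hC, hc, hdec, hinvu, hinvs, hs, hu⟩ := hA.exists_splitting
  obtain ⟨α, u, s, huE, hsE, rfl⟩ := hdec a w
  -- A component whose orbit is bounded can be moved to the bound. This isolates `u` in forward
  -- time, where `s` contracts, and `s` in backward time, where `u` does.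
  have key : ∀ t (x z : 𝔼), x + z = u + s →
      tangentNorm (φ t a) (flowDeriv φ t a z) ≤ C * tangentNorm a z → ∃ b : ℝ,
      tangentNorm (φ t a) (flowDeriv φ t a x + b • modelVector V (φ t a)) ≤
        B + C * tangentNorm a z := by
    intro t x z hxz hz
    obtain ⟨b, hb⟩ := hB t
    refine ⟨α + b, ?_⟩
    rw [add_assoc, ← hxz, map_add, map_smul, map_add, hφ.flowDeriv_vectorField] at hb
    have := tangentNorm_add_le (φ t a) (α • modelVector V (φ t a) +
      (flowDeriv φ t a x + flowDeriv φ t a z) + b • modelVector V (φ t a))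
      ((-1 : ℝ) • flowDeriv φ t a z)
    rw [tangentNorm_smul, abs_neg, abs_one, one_mul] at this
    have e : α • modelVector V (φ t a) + (flowDeriv φ t a x + flowDeriv φ t a z) +
        b • modelVector V (φ t a) + (-1 : ℝ) • flowDeriv φ t a z =
        flowDeriv φ t a x + (α + b) • modelVector V (φ t a) := by
      module
    rw [e] at this
    linarith
  have hexp : ∀ t, 0 < t → ∀ r : ℝ, 0 ≤ r → C * Real.exp (-c * t) * r ≤ C * r := by
    intro t ht r hr
    have : Real.exp (-c * t) ≤ 1 := Real.exp_le_one_iff.2 (by nlinarith)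
    have := mul_le_mul_of_nonneg_left this hC.le
    nlinarith
  have hu0 : u = 0 := by
    refine hφ.eq_zero_of_contracted hVs hV (σ := 1) hC hc (by simp) hinvu (by simpa using hu) huE
      (B := B + C * tangentNorm a s) fun t ht => ?_
    rw [one_mul]
    exact key t u s rfl ((hs t a ht s hsE).trans (hexp t ht _ (tangentNorm_nonneg a s)))
  have hs0 : s = 0 := by
    refine hφ.eq_zero_of_contracted hVs hV (σ := -1) hC hc (by simp) hinvs (by simpa using hs) hsE
      (B := B + C * tangentNorm a u) fun t ht => ?_
    rw [neg_one_mul]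
    exact key (-t) s u (add_comm _ _)
      ((hu t a ht u huE).trans (hexp t ht _ (tangentNorm_nonneg a u)))
  exact ⟨α, by simp [hu0, hs0]⟩

/-! ### The closing estimate, by rescaling. -/

/-- Propagation of an infinitesimal displacement by the flow, with a time change. -/
theorem IsFlowOf.tendsto_displacement (hφ : IsFlowOf φ V) {a a' : ℕ → Y} {M β : ℕ → ℝ} {p : Y}
    {w : 𝔼} {b : ℝ} (τ : ℝ) (ha : Tendsto a atTop (𝓝 p)) (ha' : Tendsto a' atTop (𝓝 p))
    (hw : Tendsto (fun j => (M j)⁻¹ • (extChartAt (𝓡 m) p (a' j) - extChartAt (𝓡 m) p (a j))) atTop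
      (𝓝 w)) (hβ : Tendsto β atTop (𝓝 0)) (hb : Tendsto (fun j => (M j)⁻¹ * β j) atTop (𝓝 b)) :
    Tendsto (fun j => (M j)⁻¹ • (extChartAt (𝓡 m) (φ τ p) (φ (τ + β j) (a' j)) -
      extChartAt (𝓡 m) (φ τ p) (φ τ (a j)))) atTop
      (𝓝 (flowDeriv φ τ p w + b • modelVector V (φ τ p))) := by
  obtain ⟨A, hA, hAv⟩ := hφ.hasStrictFDerivAt_chart τ p
  have hχ : ∀ {w : ℕ → Y}, Tendsto w atTop (𝓝 p) → Tendsto (fun j => extChartAt (𝓡 m) p (w j))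
      atTop (𝓝 (extChartAt (𝓡 m) p p)) := fun hw => (continuousAt_extChartAt p).tendsto.comp hw
  have h1 : Tendsto (fun j => (τ, extChartAt (𝓡 m) p (a j))) atTop
      (𝓝 (τ, extChartAt (𝓡 m) p p)) := tendsto_const_nhds.prodMk_nhds (hχ ha)
  have h2 : Tendsto (fun j => (τ + β j, extChartAt (𝓡 m) p (a' j))) atTop
      (𝓝 (τ, extChartAt (𝓡 m) p p)) := by
    refine Tendsto.prodMk_nhds ?_ (hχ ha')
    simpa using hβ.const_add τ
  have h3 : Tendsto (fun j => (M j)⁻¹ • (((τ + β j, extChartAt (𝓡 m) p (a' j)) : ℝ × 𝔼) -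
      (τ, extChartAt (𝓡 m) p (a j)))) atTop (𝓝 (b, w)) := by
    refine (hb.prodMk_nhds hw).congr fun j => ?_
    simp
  have h4 := hA.tendsto_smul_sub h1 h2 h3
  rw [hAv] at h4
  have hsource : ∀ᶠ y in 𝓝 p, y ∈ (extChartAt (𝓡 m) p).source := extChartAt_source_mem_nhds p
  refine h4.congr' ?_
  filter_upwards [ha.eventually hsource, ha'.eventually hsource] with j h h'
  simp only [(extChartAt (𝓡 m) p).left_inv h, (extChartAt (𝓡 m) p).left_inv h']

/-- For an Anosov flow there is no infinitesimal displacement between two sequences of orbits which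
remains bounded for all times, up to time changes, and is transverse to the flow. -/
theorem IsAnosov.false_of_bounded_displacement [CompactSpace Y] (hφ : IsFlowOf φ V)
    (hA : IsAnosov φ V) (hVs : ContMDiff (𝓡 m) (𝓡 m).tangent ∞ (toSection V))
    {K₀ δ₀ ρ : ℝ} (hK₀ : 0 < K₀) (htime : ∀ (x : Y) (β : ℝ), |β| ≤ K₀⁻¹ →
      ENNReal.ofReal (K₀⁻¹ * |β|) ≤ edist (φ β x) x) (hδ₀ : 3 * δ₀ ≤ K₀⁻¹) (hρ : 0 < ρ)
    {a a' : ℕ → Y} {M : ℕ → ℝ} {p : Y} {w : 𝔼}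
    (ha : Tendsto a atTop (𝓝 p)) (ha' : Tendsto a' atTop (𝓝 p)) (hM : ∀ j, 0 < M j)
    (hM0 : Tendsto M atTop (𝓝 0)) (haa : ∀ j, edist (a' j) (a j) ≤ ENNReal.ofReal (2 * M j))
    (hw : Tendsto (fun j => (M j)⁻¹ • (extChartAt (𝓡 m) p (a' j) - extChartAt (𝓡 m) p (a j))) atTop
      (𝓝 w))
    (hQ : ∀ τ : ℝ, ∀ᶠ j in atTop, ∃ β, |β| ≤ 3 * δ₀ ∧
      edist (φ (τ + β) (a' j)) (φ τ (a j)) ≤ ENNReal.ofReal (3 * M j))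
    (hfar : ∀ᶠ j in atTop, ∀ β, |β| ≤ ρ →
      ENNReal.ofReal (M j / 2) ≤ edist (φ β (a' j)) (a j)) : False := by
  have hcont : Continuous fun p : ℝ × Y => φ p.1 p.2 := hφ.smooth.continuous
  obtain ⟨C, hC, hCn⟩ := exists_tangentNorm_le_of_tendsto (m := m) (Y := Y)
  have hbdd : ∀ τ, ∃ b : ℝ,
      tangentNorm (φ τ p) (flowDeriv φ τ p w + b • modelVector V (φ τ p)) ≤ C * 3 := by
    intro τ
    obtain ⟨L, hL, hLip⟩ := hφ.exists_lipschitz |τ|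
    obtain ⟨β, hβ⟩ := (hQ τ).choice
    -- The time shifts are `O(M j)`: flowing back by `τ`, the point `φ (β j) (a' j)` is within `3 L
    -- M j` of `a j`, hence within `(3 L + 2) M j` of `a' j`, and the lower speed bound applies.
    have hβM : ∀ᶠ j in atTop, (M j)⁻¹ * β j ∈ Metric.closedBall (0 : ℝ) (K₀ * (3 * L + 2)) := by
      filter_upwards [hβ] with j ⟨h1, h2⟩
      have e1 : edist (φ (β j) (a' j)) (a j) ≤ ENNReal.ofReal (L * (3 * M j)) := by
        have := hLip (-τ) (by simp) (φ (τ + β j) (a' j)) (φ τ (a j))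
        rw [← φ.map_add, ← φ.map_add, neg_add_cancel_left, neg_add_cancel, φ.map_zero_apply] at this
        refine this.trans ?_
        rw [ENNReal.ofReal_mul hL.le]
        gcongr
      have e2 := htime (a' j) (β j) (h1.trans hδ₀)
      have hMj := hM j
      have e3 : ENNReal.ofReal (K₀⁻¹ * |β j|) ≤ ENNReal.ofReal (L * (3 * M j) + 2 * M j) := by
        rw [ENNReal.ofReal_add (by positivity) (by positivity)]
        refine e2.trans ((edist_triangle _ (a j) _).trans (add_le_add e1 ?_))
        rw [edist_comm]
        exact haa j
      rw [ENNReal.ofReal_le_ofReal_iff (by positivity), inv_mul_le_iff₀ hK₀] at e3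
      rw [mem_closedBall_zero_iff, norm_mul, Real.norm_eq_abs, Real.norm_eq_abs, abs_inv,
        abs_of_pos hMj, inv_mul_le_iff₀ hMj]
      linarith
    obtain ⟨b, -, θ, hθ, hb⟩ := tendsto_subseq_of_frequently_bounded
      Metric.isBounded_closedBall hβM.frequently
    have hβ0 : Tendsto (β ∘ θ) atTop (𝓝 0) := by
      have := (hM0.comp hθ.tendsto_atTop).mul hb
      rw [zero_mul] at this
      refine this.congr fun j => ?_
      simp only [Function.comp]
      rw [mul_inv_cancel_left₀ (hM _).ne']
    have hlim := hφ.tendsto_displacement τ (ha.comp hθ.tendsto_atTop) (ha'.comp hθ.tendsto_atTop)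
      (M := M ∘ θ) (hw.comp hθ.tendsto_atTop) hβ0 hb
    refine ⟨b, hCn _ _ _ (M ∘ θ) 3 _ (by norm_num) ?_ ?_ (fun j => hM _) ?_ hlim⟩
    · have := (hcont.tendsto (τ, p)).comp
        (tendsto_const_nhds.prodMk_nhds (ha.comp hθ.tendsto_atTop))
      exact this
    · have h1 : Tendsto (fun j => τ + (β ∘ θ) j) atTop (𝓝 τ) := by simpa using hβ0.const_add τ
      exact (hcont.tendsto (τ, p)).comp (h1.prodMk_nhds (ha'.comp hθ.tendsto_atTop))
    · exact (hθ.tendsto_atTop.eventually hβ).mono fun j hj => hj.2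
  obtain ⟨b, rfl⟩ := hA.exists_eq_smul_of_bounded hφ hVs hbdd
  -- The shift `-b M j` cancels the limit displacement `b V`. The distance left is `o(M j)`,
  -- eventually at most `M j / 4`, which contradicts `hfar`.
  have hβ0 : Tendsto (fun j => M j * -b) atTop (𝓝 0) := by simpa using hM0.mul_const (-b)
  have hβb : Tendsto (fun j => (M j)⁻¹ * (M j * -b)) atTop (𝓝 (-b)) :=
    tendsto_const_nhds.congr fun j => by rw [inv_mul_cancel_left₀ (hM j).ne']
  have hlim := hφ.tendsto_displacement 0 ha ha' hw hβ0 hβb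
  simp only [φ.map_zero_apply, flowDeriv_zero, zero_add, neg_smul, add_neg_cancel] at hlim
  obtain ⟨C₂, hC₂, H₂⟩ := exists_edist_le_edist_extChartAt (m := m) p
  have hlim' := hlim.norm
  rw [norm_zero] at hlim'
  have hφa : Tendsto (fun j => φ (M j * -b) (a' j)) atTop (𝓝 p) := by
    have := (hcont.tendsto (0, p)).comp (hβ0.prodMk_nhds ha')
    rw [φ.map_zero_apply] at this
    exact this
  have hC₂' : (0 : ℝ) < C₂ := by positivity
  obtain ⟨j, h1, h2, h3, h4⟩ := ((hlim'.eventually_lt_const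
    (show (0 : ℝ) < (4 * (C₂ : ℝ))⁻¹ by positivity)).and (hfar.and ((hβ0.norm.eventually_lt_const
      (by simpa using hρ : ‖(0 : ℝ)‖ < ρ)).and ((hφa.prodMk_nhds ha).eventually H₂)))).exists
  have h5 := (h2 _ h3.le).trans h4
  rw [edist_dist, dist_eq_norm, ← ENNReal.ofReal_coe_nnreal, ← ENNReal.ofReal_mul (by positivity),
    ENNReal.ofReal_le_ofReal_iff (by positivity)] at h5
  have hMj := hM j
  rw [norm_smul, norm_inv, Real.norm_of_nonneg hMj.le, inv_mul_lt_iff₀ hMj] at h1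
  have h6 : M j / 2 ≤ C₂ * (M j * (4 * (C₂ : ℝ))⁻¹) := h5.trans (by gcongr)
  have h7 : C₂ * (M j * (4 * (C₂ : ℝ))⁻¹) = M j / 4 := by field_simp
  linarith

/-- Two pseudo-closed orbits which are close for one period remain close for a longer time, up to a
time change. -/
theorem exists_edist_le_of_pseudo_closed {Y : Type*} [EMetricSpace Y] {φ : Flow ℝ Y} {x x' : Y}
    {t t' t₀ δ₀ η N : ℝ} {ε D L : ℝ≥0∞} {n : ℕ} (ht₀ : 0 ≤ t₀) (ht : t₀ ≤ t) (htt : |t - t'| ≤ η)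
    (hx : edist (φ t x) x ≤ ε) (hx' : edist (φ t' x') x' ≤ ε) (hN : n * t₀ + δ₀ + n * η ≤ N)
    (hL : ∀ s, |s| ≤ N → ∀ p q, edist (φ s p) (φ s q) ≤ L * edist p q)
    (hδ₀ : 0 ≤ δ₀)
    (h : ∀ s ∈ Icc 0 t, ∃ σ, |σ| ≤ δ₀ ∧ edist (φ (s + σ) x') (φ s x) ≤ D) :
    ∀ k : ℕ, k ≤ n → ∀ s ∈ Icc (-(k * t₀)) (t + k * t₀), ∃ σ, |σ| ≤ δ₀ + k * η ∧
      edist (φ (s + σ) x') (φ s x) ≤ D + k * (2 * (L * ε)) := by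
  have hη : 0 ≤ η := (abs_nonneg _).trans htt
  intro k
  induction k with
  | zero => simpa using h
  | succ k ih =>
    intro hk s hs
    have ih := ih (by omega)
    push_cast at hs ⊢
    have hkn : ((k : ℝ) + 1) ≤ n := by exact_mod_cast hk
    have hN' : (k + 1) * t₀ + δ₀ + (k + 1) * η ≤ N := by
      refine le_trans ?_ hN
      gcongr
    have hk0 : (0 : ℝ) ≤ k := k.cast_nonneg
    have hkt := mul_nonneg hk0 ht₀
    have hkη := mul_nonneg hk0 hη
    have e : D + (k + 1) * (2 * (L * ε)) = L * ε + (D + k * (2 * (L * ε))) + L * ε := by ring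
    -- A time beyond the known interval is moved back into it by one period, replacing `x`, `x'` by
    -- `φ t x`, `φ t' x'`. The shift changes by `t' - t`, and each replacement costs `L ε`. The flow
    -- times involved are bounded by `N`, not by `t`, so `L` does not depend on the period.
    rcases lt_or_ge (t + k * t₀) s with h1 | h1
    · obtain ⟨σ, hσ, hd⟩ := ih (s - t) ⟨by linarith, by nlinarith [hs.2]⟩
      refine ⟨σ + (t' - t), ?_, ?_⟩
      · rw [abs_sub_comm] at htt
        linarith [abs_add_le σ (t' - t)]
      · rw [e]
        have a1 : φ (s + (σ + (t' - t))) x' = φ (s - t + σ) (φ t' x') := by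
          rw [← φ.map_add]; ring_nf
        have a2 : φ s x = φ (s - t) (φ t x) := by
          rw [← φ.map_add]; ring_nf
        rw [a1, a2]
        refine (edist_triangle4 _ (φ (s - t + σ) x') (φ (s - t) x) _).trans
          (add_le_add (add_le_add ?_ hd) ?_)
        · refine (hL _ ?_ _ _).trans (by gcongr)
          rw [abs_le] at hσ ⊢
          constructor <;> nlinarith [hs.2, hσ.1, hσ.2]
        · rw [edist_comm]
          refine (hL _ ?_ _ _).trans (by gcongr)
          rw [abs_le]
          constructor <;> nlinarith [hs.2]
    · rcases lt_or_ge s (-(k * t₀)) with h2 | h2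
      · obtain ⟨σ, hσ, hd⟩ := ih (s + t) ⟨by nlinarith [hs.1], by nlinarith⟩
        refine ⟨σ + (t - t'), ?_, ?_⟩
        · linarith [abs_add_le σ (t - t')]
        · rw [e]
          have a1 : φ (s + t + σ) x' = φ (s + (σ + (t - t'))) (φ t' x') := by
            rw [← φ.map_add]; ring_nf
          have a2 : φ (s + t) x = φ s (φ t x) := φ.map_add s t x
          rw [a1, a2] at hd
          refine (edist_triangle4 _ (φ (s + (σ + (t - t'))) (φ t' x')) (φ s (φ t x)) _).trans
            (add_le_add (add_le_add ?_ hd) ?_)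
          · rw [edist_comm]
            refine (hL _ ?_ _ _).trans (by gcongr)
            rw [abs_le] at hσ htt ⊢
            constructor <;> nlinarith [hs.1, hσ.1, hσ.2, htt.1, htt.2]
          · refine (hL _ ?_ _ _).trans (by gcongr)
            rw [abs_le]
            constructor <;> nlinarith [hs.1]
      · obtain ⟨σ, hσ, hd⟩ := ih s ⟨h2, h1⟩
        refine ⟨σ, by linarith, hd.trans ?_⟩
        gcongr
        exact le_self_add

/-- Two orbits which are close for times in `[0, t]` but not at time `0`, up to time changes, have a
time where their distance up to time changes is comparable to its supremum. -/
theorem exists_near_maximal_time {Y : Type*} [EMetricSpace Y] {φ : Flow ℝ Y} {x x' : Y}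
    {t δ₀ κ η : ℝ} (ht : 0 ≤ t) (hδ₀ : 0 ≤ δ₀) (hκ : 0 < κ)
    (h : ∀ s ∈ Icc 0 t, edist (φ s x') (φ s x) ≤ ENNReal.ofReal η)
    (hfar : ∀ σ, |σ| ≤ δ₀ → ENNReal.ofReal κ < edist (φ σ x') x) :
    ∃ M s : ℝ, κ ≤ M ∧ M ≤ η ∧ s ∈ Icc 0 t ∧
      (∀ s ∈ Icc 0 t, ∃ σ, |σ| ≤ δ₀ ∧ edist (φ (s + σ) x') (φ s x) ≤ ENNReal.ofReal (2 * M)) ∧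
      ∀ σ, |σ| ≤ δ₀ → ENNReal.ofReal (M / 2) ≤ edist (φ (s + σ) x') (φ s x) := by
  -- Distance of the orbits modulo time shifts. Its supremum `R` need not be attained; the factors
  -- `2` and `1 / 2` give strict inequalities because `R` is positive and finite.
  set r : ℝ → ℝ≥0∞ := fun s => ⨅ σ ∈ {σ : ℝ | |σ| ≤ δ₀}, edist (φ (s + σ) x') (φ s x) with hr
  set R : ℝ≥0∞ := ⨆ s ∈ Icc 0 t, r s with hR
  have hRη : R ≤ ENNReal.ofReal η := by
    refine iSup₂_le fun s hs => (iInf₂_le (0 : ℝ) (by simpa using hδ₀)).trans ?_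
    simpa using h s hs
  have hκR : ENNReal.ofReal κ ≤ R := by
    refine le_trans ?_ (le_iSup₂ (f := fun s (_ : s ∈ Icc 0 t) => r s) 0 ⟨le_rfl, ht⟩)
    refine le_iInf₂ fun σ hσ => ?_
    simpa using (hfar σ hσ).le
  have hRtop : R ≠ ⊤ := (hRη.trans_lt ENNReal.ofReal_lt_top).ne
  have hRM : ENNReal.ofReal R.toReal = R := ENNReal.ofReal_toReal hRtop
  have hκM : κ ≤ R.toReal := by
    rw [← hRM] at hκR
    exact (ENNReal.ofReal_le_ofReal_iff ENNReal.toReal_nonneg).1 hκR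
  have hM : 0 < R.toReal := hκ.trans_le hκM
  have hlt : ENNReal.ofReal (R.toReal / 2) < R := by
    conv_rhs => rw [← hRM]
    exact (ENNReal.ofReal_lt_ofReal_iff hM).2 (by linarith)
  rw [hR] at hlt
  simp only [lt_iSup_iff, exists_prop] at hlt
  obtain ⟨s, hs, hlt⟩ := hlt
  refine ⟨R.toReal, s, hκM, ?_, hs, fun s' hs' => ?_, fun σ hσ => ?_⟩
  · have hη : 0 ≤ η := by
      by_contra hη
      rw [ENNReal.ofReal_of_nonpos (not_le.1 hη).le] at hRη
      rw [nonpos_iff_eq_zero.1 hRη] at hM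
      simp at hM
    exact ENNReal.toReal_le_of_le_ofReal hη hRη
  · have : r s' < ENNReal.ofReal (2 * R.toReal) := by
      refine (le_iSup₂ (f := fun s (_ : s ∈ Icc 0 t) => r s) s' hs').trans_lt ?_
      change R < _
      conv_lhs => rw [← hRM]
      exact (ENNReal.ofReal_lt_ofReal_iff (by linarith)).2 (by linarith)
    simp only [hr, iInf_lt_iff, exists_prop] at this
    obtain ⟨σ, hσ, h'⟩ := this
    exact ⟨σ, hσ, h'.le⟩
  · exact hlt.le.trans (iInf₂_le (f := fun σ (_ : σ ∈ {σ : ℝ | |σ| ≤ δ₀}) =>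
      edist (φ (s + σ) x') (φ s x)) σ hσ)

/-- The closing estimate: two almost closed orbits of an Anosov flow with almost the same period,
which stay close for one period, are almost the same orbit. -/
theorem IsAnosov.exists_closing [CompactSpace Y] (hφ : IsFlowOf φ V)
    (hA : IsAnosov φ V) (hVs : ContMDiff (𝓡 m) (𝓡 m).tangent ∞ (toSection V))
    {t₀ : ℝ} (ht₀ : 0 < t₀) : ∃ δ K : ℝ, 0 < δ ∧ 0 < K ∧ ∀ (ε : ℝ) (x x' : Y) (t t' : ℝ), 0 < ε →
      t₀ ≤ t → |t - t'| ≤ δ → edist (φ t x) x ≤ ENNReal.ofReal ε →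
      edist (φ t' x') x' ≤ ENNReal.ofReal ε →
      (∀ s ∈ Icc 0 t, edist (φ s x') (φ s x) ≤ ENNReal.ofReal δ) →
      ∃ σ : ℝ, |σ| ≤ 1 ∧ edist (φ σ x') x ≤ ENNReal.ofReal (K * ε) := by
  -- Shifts up to `3 δ₀` occur below (at most `2 δ₀` after extension by periodicity, minus a `σ j`
  -- of size `δ₀`), and all must lie in the range `K₀⁻¹` of the speed bound.
  obtain ⟨K₀, hK₀, htime⟩ := hφ.exists_edist_time hA.1
  set δ₀ := min 1 (K₀⁻¹ / 3) with hδ₀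
  have hδ₀pos : 0 < δ₀ := by positivity
  have hδ₀K : 3 * δ₀ ≤ K₀⁻¹ := by
    have := min_le_right 1 (K₀⁻¹ / 3)
    linarith
  by_contra! hcon
  have hj : ∀ j : ℕ, (0 : ℝ) < 1 / ((j : ℝ) + 1) := fun j => Nat.one_div_pos_of_nat
  choose ε x x' t t' hε ht htt hx hx' hsh hfar using fun j : ℕ =>
    hcon (1 / ((j : ℝ) + 1)) ((j : ℝ) + 1) (hj j) (by positivity)
  choose M s hκM hMη hs hnear hfar' using fun j : ℕ =>
    exists_near_maximal_time (ht₀.le.trans (ht j)) hδ₀pos.le (mul_pos (by positivity) (hε j))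
      (hsh j) (fun σ hσ => hfar j σ (hσ.trans (min_le_left _ _)))
  choose σ hσ hσd using fun j => hnear j (s j) (hs j)
  have hM : ∀ j, 0 < M j := fun j => (mul_pos (by positivity) (hε j)).trans_le (hκM j)
  have hj0 : Tendsto (fun j : ℕ => 1 / ((j : ℝ) + 1)) atTop (𝓝 0) :=
    tendsto_one_div_add_atTop_nhds_zero_nat
  have hM0 : Tendsto M atTop (𝓝 0) := squeeze_zero (fun j => (hM j).le) hMη hj0
  -- The failing constant is `K = j + 1`, so the return error is negligible at the scale `M j`.
  have hεM : ∀ j, ε j ≤ M j * (1 / ((j : ℝ) + 1)) := fun j => by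
    rw [mul_one_div, le_div_iff₀ (by positivity)]
    linarith [hκM j]
  have hσ0 : Tendsto σ atTop (𝓝 0) := by
    have hb : ∀ j, ‖σ j‖ ≤ K₀ * (3 * (1 / ((j : ℝ) + 1))) := fun j => by
      have h1 := (htime (φ (s j) (x' j)) (σ j) ((hσ j).trans (by linarith))).1
      rw [← φ.map_add, add_comm] at h1
      have h2 := h1.trans ((edist_triangle _ (φ (s j) (x j)) _).trans
        (add_le_add (hσd j) ((edist_comm _ _).trans_le (hsh j (s j) (hs j)))))
      have := hM j
      have := hj j
      rw [← ENNReal.ofReal_add (by positivity) (by positivity),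
        ENNReal.ofReal_le_ofReal_iff (by positivity), inv_mul_le_iff₀ hK₀] at h2
      refine h2.trans (mul_le_mul_of_nonneg_left ?_ hK₀.le)
      linarith [hMη j]
    refine squeeze_zero_norm hb ?_
    simpa using (hj0.const_mul 3).const_mul K₀
  set a : ℕ → Y := fun j => φ (s j) (x j) with ha
  set a' : ℕ → Y := fun j => φ (s j + σ j) (x' j) with ha'
  have hQ : ∀ τ : ℝ, ∀ᶠ j in atTop, ∃ β, |β| ≤ 3 * δ₀ ∧
      edist (φ (τ + β) (a' j)) (φ τ (a j)) ≤ ENNReal.ofReal (3 * M j) := by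
    intro τ
    obtain ⟨n, hn⟩ := exists_nat_ge (|τ| / t₀)
    rw [div_le_iff₀ ht₀] at hn
    obtain ⟨L, hL, hLip⟩ := hφ.exists_lipschitz (n * t₀ + δ₀ + n)
    -- For `n` fixed and `j` large, the accumulated shift is at most `δ₀` and the accumulated error
    -- `2 n L ε j` at most `M j`, which turns `2 M j` into `3 M j`.
    have l1 : Tendsto (fun j : ℕ => n * (1 / ((j : ℝ) + 1))) atTop (𝓝 0) := by
      simpa using hj0.const_mul (n : ℝ)
    have l2 : Tendsto (fun j : ℕ => n * (2 * L) * (1 / ((j : ℝ) + 1))) atTop (𝓝 0) := by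
      simpa using hj0.const_mul (n * (2 * L))
    filter_upwards [l1.eventually_le_const hδ₀pos, l2.eventually_le_const one_pos] with j h1 h2
    have hj1 : 1 / ((j : ℝ) + 1) ≤ 1 := by
      rw [div_le_one (by positivity)]; linarith [j.cast_nonneg (α := ℝ)]
    obtain ⟨β, hβ, hβd⟩ := exists_edist_le_of_pseudo_closed (n := n) ht₀.le (ht j) (htt j) (hx j)
      (hx' j) (N := n * t₀ + δ₀ + n) (by
        have := mul_le_mul_of_nonneg_left hj1 (n.cast_nonneg (α := ℝ))
        linarith) hLip hδ₀pos.le (hnear j) n le_rfl (s j + τ) (by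
          have := abs_le.1 hn
          have := hs j
          constructor <;> linarith [this.1, this.2])
    refine ⟨β - σ j, ?_, ?_⟩
    · have := abs_sub β (σ j)
      linarith [hσ j]
    · have e1 : φ (τ + (β - σ j)) (a' j) = φ (s j + τ + β) (x' j) := by
        rw [← φ.map_add]; ring_nf
      have e2 : φ τ (a j) = φ (s j + τ) (x j) := by
        rw [← φ.map_add, add_comm]
      rw [e1, e2]
      refine hβd.trans ?_
      have hMj := hM j
      have hεj := hε j
      rw [← ENNReal.ofReal_natCast n, ← ENNReal.ofReal_mul hL.le,
        show (2 : ℝ≥0∞) = ENNReal.ofReal 2 by simp, ← ENNReal.ofReal_mul (by positivity),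
        ← ENNReal.ofReal_mul (by positivity), ← ENNReal.ofReal_add (by positivity) (by positivity)]
      refine ENNReal.ofReal_le_ofReal ?_
      have h3 : n * (2 * L) * ε j ≤ n * (2 * L) * (M j * (1 / ((j : ℝ) + 1))) := by
        gcongr
        exact hεM j
      have h4 : n * (2 * L) * (1 / ((j : ℝ) + 1)) * M j ≤ 1 * M j := by gcongr
      linarith
  have hfar2 : ∀ᶠ j in atTop, ∀ β, |β| ≤ δ₀ / 2 →
      ENNReal.ofReal (M j / 2) ≤ edist (φ β (a' j)) (a j) := by
    have : Tendsto (fun j => |σ j|) atTop (𝓝 0) := by simpa using hσ0.abs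
    filter_upwards [this.eventually_le_const (half_pos hδ₀pos)] with j hj β hβ
    have := hfar' j (σ j + β) ((abs_add_le _ _).trans (by linarith))
    rwa [show s j + (σ j + β) = β + (s j + σ j) by ring, φ.map_add] at this
  -- Two extractions: the base points converge, then the displacements divided by `M`.
  obtain ⟨p, θ, hθ, hp⟩ := CompactSpace.tendsto_subseq a
  have hp' : Tendsto (a' ∘ θ) atTop (𝓝 p) := by
    have h2 : Tendsto (fun j => ENNReal.ofReal (2 * M (θ j))) atTop (𝓝 0) := by
      have := ENNReal.tendsto_ofReal ((hM0.comp hθ.tendsto_atTop).const_mul 2)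
      simpa using this
    have h3 := h2.add (tendsto_iff_edist_tendsto_0.1 hp)
    rw [add_zero] at h3
    exact tendsto_iff_edist_tendsto_0.2 (tendsto_of_tendsto_of_tendsto_of_le_of_le
      tendsto_const_nhds h3 (fun _ => zero_le) fun j =>
        (edist_triangle _ (a (θ j)) _).trans (add_le_add (hσd (θ j)) le_rfl))
  obtain ⟨C₁, hC₁, H₁⟩ := exists_edist_extChartAt_le (m := m) p
  have hbdd : ∀ᶠ j in atTop, (M (θ j))⁻¹ • (extChartAt (𝓡 m) p (a' (θ j)) -
      extChartAt (𝓡 m) p (a (θ j))) ∈ Metric.closedBall (0 : 𝔼) (C₁ * 2) := by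
    filter_upwards [(hp'.prodMk_nhds hp).eventually H₁] with j h1
    have h2 := h1.trans (mul_le_mul_right (hσd (θ j)) _)
    have hMj := hM (θ j)
    rw [edist_dist, dist_eq_norm, ← ENNReal.ofReal_coe_nnreal, ← ENNReal.ofReal_mul (by positivity),
      ENNReal.ofReal_le_ofReal_iff (by positivity)] at h2
    rw [mem_closedBall_zero_iff, norm_smul, norm_inv, Real.norm_of_nonneg hMj.le,
      inv_mul_le_iff₀ hMj]
    refine h2.trans_eq (by ring)
  obtain ⟨w, -, θ', hθ', hw⟩ := tendsto_subseq_of_frequently_bounded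
    Metric.isBounded_closedBall hbdd.frequently
  have hΘ := hθ.tendsto_atTop.comp hθ'.tendsto_atTop
  exact hA.false_of_bounded_displacement hφ hVs hK₀ (fun x β hβ => (htime x β hβ).1) hδ₀K
    (half_pos hδ₀pos) (a := a ∘ θ ∘ θ') (a' := a' ∘ θ ∘ θ') (M := M ∘ θ ∘ θ')
    (hp.comp hθ'.tendsto_atTop) (hp'.comp hθ'.tendsto_atTop) (fun j => hM _) (hM0.comp hΘ)
    (fun j => hσd _) hw (fun τ => hΘ.eventually (hQ τ)) (hΘ.eventually hfar2)

/-! ### Volumes of balls and coverings. -/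

theorem exists_chart_bilipschitz [CompactSpace Y] (c : Y) : ∃ C : ℝ≥0, C ≠ 0 ∧ ∃ U ∈ 𝓝 c,
    U ⊆ (extChartAt (𝓡 m) c).source ∧ ∀ x ∈ U, ∀ y ∈ U,
      edist (extChartAt (𝓡 m) c x) (extChartAt (𝓡 m) c y) ≤ C * edist x y ∧
      edist x y ≤ C * edist (extChartAt (𝓡 m) c x) (extChartAt (𝓡 m) c y) := by
  obtain ⟨C₁, hC₁, H₁⟩ := exists_edist_extChartAt_le (m := m) c
  obtain ⟨C₂, hC₂, H₂⟩ := exists_edist_le_edist_extChartAt (m := m) c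
  have H := H₁.and H₂
  rw [nhds_prod_eq] at H
  obtain ⟨U, hU, hUH⟩ := mem_prod_self_iff.1 H
  refine ⟨max C₁ C₂, (lt_max_of_lt_left (pos_iff_ne_zero.2 hC₁)).ne',
    U ∩ (extChartAt (𝓡 m) c).source, inter_mem hU (extChartAt_source_mem_nhds c),
    inter_subset_right, fun x hx y hy => ?_⟩
  obtain ⟨h1, h2⟩ := hUH (show (x, y) ∈ U ×ˢ U from ⟨hx.1, hy.1⟩)
  exact ⟨h1.trans (by gcongr; exact le_max_left _ _), h2.trans (by gcongr; exact le_max_right _ _)⟩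

/-- Lipschitz maps multiply the volume by at most the `m`-th power of the Lipschitz constant. -/
theorem euclideanHausdorffMeasure_image_le {X Z : Type*} [EMetricSpace X] [EMetricSpace Z]
    [MeasurableSpace X] [BorelSpace X] [MeasurableSpace Z] [BorelSpace Z] {K : ℝ≥0} {f : X → Z}
    {s : Set X} (h : LipschitzOnWith K f s) (d : ℕ) :
    (Measure.euclideanHausdorffMeasure d : Measure Z) (f '' s) ≤
      (K : ℝ≥0∞) ^ d * (Measure.euclideanHausdorffMeasure d : Measure X) s := by
  have h1 := h.hausdorffMeasure_image_le (d := d) d.cast_nonneg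
  simp only [Measure.euclideanHausdorffMeasure_def, Measure.smul_apply, ENNReal.rpow_natCast,
    ENNReal.smul_def, smul_eq_mul] at h1 ⊢
  rw [mul_left_comm]
  gcongr

/-- The volume of small balls of radius `r` is at most of order `r ^ m`. -/
theorem exists_volume_closedEBall_le [CompactSpace Y] [MeasurableSpace Y] [BorelSpace Y] :
    ∃ K : ℝ, 0 < K ∧ ∀ (x : Y) (r : ℝ), 0 < r → r ≤ K⁻¹ →
      riemannianVolume Y m (Metric.closedEBall x (ENNReal.ofReal r)) ≤
        ENNReal.ofReal (K * r ^ m) := by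
  suffices h : ∃ K : ℝ, 0 < K ∧ ∀ x ∈ (univ : Set Y), 0 < K ∧ ∀ r : ℝ, 0 < r → r ≤ K⁻¹ →
      riemannianVolume Y m (Metric.closedEBall x (ENNReal.ofReal r)) ≤
        ENNReal.ofReal (K * r ^ m) by
    obtain ⟨K, hK, h⟩ := h
    exact ⟨K, hK, fun x => (h x (mem_univ x)).2⟩
  refine (isCompact_univ (X := Y)).exists_bound_of_eventually (P := fun x K => 0 < K ∧ ∀ r : ℝ,
      0 < r → r ≤ K⁻¹ → riemannianVolume Y m (Metric.closedEBall x (ENNReal.ofReal r)) ≤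
        ENNReal.ofReal (K * r ^ m)) ?_ ?_
  · rintro x a b hab ⟨ha, h⟩
    refine ⟨ha.trans_le hab, fun r hr hrb => (h r hr (hrb.trans (inv_anti₀ ha hab))).trans ?_⟩
    gcongr
  · intro c _
    obtain ⟨C, hC, U, hU, hUs, H⟩ := exists_chart_bilipschitz (m := m) c
    obtain ⟨ρ, hρ, hρU⟩ := EMetric.mem_nhds_iff.1 hU
    obtain ⟨ρ', hρ'0, hρ'⟩ := ENNReal.lt_iff_exists_nnreal_btwn.1 hρ
    have hρ'0 : (0 : ℝ) < ρ' := by simpa using hρ'0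
    obtain ⟨b₁, hb₁, hvol⟩ : ∃ b₁ : ℝ, 0 ≤ b₁ ∧
        volume (Metric.ball (0 : 𝔼) 1) = ENNReal.ofReal b₁ :=
      ⟨_, ENNReal.toReal_nonneg, (ENNReal.ofReal_toReal measure_ball_lt_top.ne).symm⟩
    refine ⟨max (2 / ρ') (C ^ m * (C ^ m * b₁)), ?_⟩
    have hpos : 0 < max (2 / ρ' : ℝ) (C ^ m * (C ^ m * b₁)) :=
      lt_max_of_lt_left (by positivity)
    filter_upwards [Metric.eball_mem_nhds c (ENNReal.ofReal_pos.2 (half_pos hρ'0))] with x hx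
    refine ⟨hpos, fun r hr hrK => ?_⟩
    have hr' : r ≤ ρ' / 2 := by
      have := inv_anti₀ (show (0 : ℝ) < 2 / ρ' by positivity)
        (le_max_left (2 / ρ' : ℝ) (C ^ m * (C ^ m * b₁)))
      rw [inv_div] at this
      exact hrK.trans this
    set B := Metric.closedEBall x (ENNReal.ofReal r) with hB
    have hBU : B ⊆ U := by
      intro y hy
      refine hρU (show edist y c < ρ from lt_trans ?_ hρ')
      refine (edist_triangle y x c).trans_lt ?_
      have e : (ρ' : ℝ≥0∞) = ENNReal.ofReal (ρ' / 2) + ENNReal.ofReal (ρ' / 2) := by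
        rw [← ENNReal.ofReal_add (by positivity) (by positivity), add_halves,
          ENNReal.ofReal_coe_nnreal]
      rw [e]
      exact ENNReal.add_lt_add_of_le_of_lt (hy.out.trans_lt ENNReal.ofReal_lt_top).ne
        (hy.out.trans (ENNReal.ofReal_le_ofReal hr')) hx
    have hxB : x ∈ B := Metric.mem_closedEBall_self
    have hlip : LipschitzOnWith C (extChartAt (𝓡 m) c).symm (extChartAt (𝓡 m) c '' B) := by
      rintro _ ⟨y, hy, rfl⟩ _ ⟨z, hz, rfl⟩
      rw [(extChartAt (𝓡 m) c).left_inv (hUs (hBU hy)),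
        (extChartAt (𝓡 m) c).left_inv (hUs (hBU hz))]
      exact (H y (hBU hy) z (hBU hz)).2
    have him : (extChartAt (𝓡 m) c).symm '' (extChartAt (𝓡 m) c '' B) = B :=
      (extChartAt (𝓡 m) c).symm_image_image_of_subset_source (hBU.trans hUs)
    have h1 := euclideanHausdorffMeasure_image_le hlip m
    rw [him, EuclideanSpace.euclideanHausdorffMeasure_eq_volume] at h1
    have h2 : extChartAt (𝓡 m) c '' B ⊆ Metric.closedBall (extChartAt (𝓡 m) c x) (C * r) := by
      rintro _ ⟨y, hy, rfl⟩
      have h3 := (H y (hBU hy) x (hBU hxB)).1.trans (mul_le_mul_right hy.out _)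
      rw [edist_dist, ← ENNReal.ofReal_coe_nnreal, ← ENNReal.ofReal_mul (by positivity),
        ENNReal.ofReal_le_ofReal_iff (by positivity)] at h3
      exact h3
    refine h1.trans ((mul_le_mul_right (measure_mono h2) _).trans ?_)
    rw [Measure.addHaar_closedBall _ _ (by positivity), finrank_euclideanSpace_fin, hvol,
      ← ENNReal.ofReal_coe_nnreal, ← ENNReal.ofReal_pow (by positivity),
      ← ENNReal.ofReal_mul (by positivity), ← ENNReal.ofReal_mul (by positivity)]
    refine ENNReal.ofReal_le_ofReal ?_
    calc (C : ℝ) ^ m * ((C * r) ^ m * b₁) = C ^ m * (C ^ m * b₁) * r ^ m := by ring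
      _ ≤ _ := by gcongr; exact le_max_right _ _

theorem riemannianVolume_univ_lt_top [CompactSpace Y] [MeasurableSpace Y] [BorelSpace Y] :
    riemannianVolume Y m (univ : Set Y) < ⊤ := by
  obtain ⟨K, hK, H⟩ := exists_volume_closedEBall_le (m := m) (Y := Y)
  refine isCompact_univ.measure_lt_top_of_nhdsWithin fun x _ => ?_
  rw [nhdsWithin_univ]
  refine ⟨Metric.closedEBall x (ENNReal.ofReal K⁻¹),
    Metric.closedEBall_mem_nhds x (by simpa using hK), ?_⟩
  exact (H x K⁻¹ (by positivity) le_rfl).trans_lt ENNReal.ofReal_lt_top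

/-- A volume bound for the cardinality of separated sets in Euclidean space. -/
theorem card_mul_pow_le_of_separated {m : ℕ} {s : Finset (EuclideanSpace ℝ (Fin m))}
    {c : EuclideanSpace ℝ (Fin m)} {R ρ : ℝ} (hR : 0 ≤ R) (hρ : 0 < ρ)
    (hs : ∀ x ∈ s, dist x c ≤ R) (hsep : ∀ x ∈ s, ∀ y ∈ s, x ≠ y → ρ ≤ dist x y) :
    (s.card : ℝ) * ρ ^ m ≤ (2 * R + ρ) ^ m := by
  have hdisj : (s : Set (EuclideanSpace ℝ (Fin m))).PairwiseDisjoint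
      fun x => Metric.ball x (ρ / 2) := fun x hx y hy hxy =>
    Metric.ball_disjoint_ball (by linarith [hsep x hx y hy hxy])
  have h1 := measure_biUnion_finset (μ := volume) hdisj fun x _ => Metric.isOpen_ball.measurableSet
  have h2 : (⋃ x ∈ s, Metric.ball x (ρ / 2)) ⊆ Metric.ball c (R + ρ / 2) := by
    refine iUnion₂_subset fun x hx => Metric.ball_subset_ball' ?_
    linarith [hs x hx]
  have h3 := measure_mono (μ := volume) h2
  simp only [h1, Measure.addHaar_ball_of_pos volume _ (half_pos hρ), Finset.sum_const,
    Measure.addHaar_ball_of_pos volume c (show 0 < R + ρ / 2 by positivity),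
    finrank_euclideanSpace_fin, nsmul_eq_mul] at h3
  rw [← mul_assoc, ENNReal.mul_le_mul_iff_left (Metric.measure_ball_pos volume _ one_pos).ne'
    measure_ball_lt_top.ne, ← ENNReal.ofReal_natCast, ← ENNReal.ofReal_mul (by positivity),
    ENNReal.ofReal_le_ofReal_iff (by positivity)] at h3
  calc (s.card : ℝ) * ρ ^ m = 2 ^ m * (s.card * (ρ / 2) ^ m) := by
        rw [div_pow]; field_simp
    _ ≤ 2 ^ m * (R + ρ / 2) ^ m := by gcongr
    _ = (2 * R + ρ) ^ m := by rw [← mul_pow]; ring_nf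

/-- In a chart an `r`-separated set is `r / C`-separated, and the Euclidean volume count applies.
Constants add over unions, hence the direct induction on compact sets. -/
theorem exists_card_separated_le [CompactSpace Y] : ∃ C : ℝ, 0 < C ∧ ∀ (r : ℝ) (s : Finset Y),
    0 < r → r ≤ 1 → (∀ x ∈ s, ∀ y ∈ s, x ≠ y → ENNReal.ofReal r ≤ edist x y) →
    (s.card : ℝ) * r ^ m ≤ C := by
  classical
  suffices h : ∃ C : ℝ, 0 < C ∧ ∀ (r : ℝ) (s : Finset Y), (s : Set Y) ⊆ univ →
    0 < r → r ≤ 1 → (∀ x ∈ s, ∀ y ∈ s, x ≠ y → ENNReal.ofReal r ≤ edist x y) →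
    (s.card : ℝ) * r ^ m ≤ C by
    obtain ⟨C, hC, h⟩ := h
    exact ⟨C, hC, fun r s => h r s (subset_univ _)⟩
  refine (isCompact_univ (X := Y)).induction_on (p := fun u => ∃ C : ℝ, 0 < C ∧
    ∀ (r : ℝ) (s : Finset Y), (s : Set Y) ⊆ u →
    0 < r → r ≤ 1 → (∀ x ∈ s, ∀ y ∈ s, x ≠ y → ENNReal.ofReal r ≤ edist x y) →
    (s.card : ℝ) * r ^ m ≤ C) ?_ ?_ ?_ ?_
  · refine ⟨1, one_pos, fun r s hs _ _ _ => ?_⟩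
    have : s = ∅ := by simpa using hs
    simp [this]
  · rintro u v huv ⟨C, hC, h⟩
    exact ⟨C, hC, fun r s hs => h r s (hs.trans huv)⟩
  · rintro u v ⟨C, hC, h⟩ ⟨C', hC', h'⟩
    refine ⟨C + C', by positivity, fun r s hs hr hr1 hsep => ?_⟩
    have h1 := h r (s.filter (· ∈ u)) (fun x hx => (Finset.mem_filter.1 hx).2) hr hr1
      fun x hx y hy => hsep x (Finset.mem_filter.1 hx).1 y (Finset.mem_filter.1 hy).1
    have h2 := h' r (s.filter (· ∉ u)) (fun x hx => (hs (Finset.mem_filter.1 hx).1).resolve_left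
      (Finset.mem_filter.1 hx).2) hr hr1
      fun x hx y hy => hsep x (Finset.mem_filter.1 hx).1 y (Finset.mem_filter.1 hy).1
    have h3 := Finset.card_filter_add_card_filter_not (s := s) (· ∈ u)
    rw [← h3]
    push_cast
    linarith
  · intro c _
    obtain ⟨C, hC, U, hU, hUs, H⟩ := exists_chart_bilipschitz (m := m) c
    have hχ : ContinuousAt (extChartAt (𝓡 m) c) c := continuousAt_extChartAt c
    have hU' := inter_mem hU (hχ.preimage_mem_nhds (Metric.closedBall_mem_nhds _ one_pos))
    have hC0 : (0 : ℝ) < C := by positivity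
    refine ⟨_, mem_nhdsWithin_of_mem_nhds hU', (2 * C + 1) ^ m, by positivity,
      fun r s hs hr hr1 hsep => ?_⟩
    have hinj : InjOn (extChartAt (𝓡 m) c) s := (extChartAt (𝓡 m) c).injOn.mono
      fun x hx => hUs (hs hx).1
    have := card_mul_pow_le_of_separated (s := s.image (extChartAt (𝓡 m) c))
      (c := extChartAt (𝓡 m) c c) (R := 1) (ρ := r / C) (by norm_num) (by positivity) ?_ ?_
    · rw [Finset.card_image_of_injOn hinj] at this
      calc (s.card : ℝ) * r ^ m = C ^ m * (s.card * (r / C) ^ m) := by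
            rw [div_pow]; field_simp
        _ ≤ C ^ m * (2 * 1 + r / C) ^ m := by gcongr
        _ = (2 * C + r) ^ m := by
            rw [← mul_pow]; congr 1; field_simp
        _ ≤ _ := by gcongr
    · intro z hz
      obtain ⟨x, hx, rfl⟩ := Finset.mem_image.1 hz
      exact (hs hx).2
    · intro z hz z' hz' hne
      obtain ⟨x, hx, rfl⟩ := Finset.mem_image.1 hz
      obtain ⟨y, hy, rfl⟩ := Finset.mem_image.1 hz'
      have h1 := (hsep x hx y hy (fun e => hne (by rw [e]))).trans (H x (hs hx).1 y (hs hy).1).2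
      rw [edist_dist, ← ENNReal.ofReal_coe_nnreal, ← ENNReal.ofReal_mul (by positivity),
        ENNReal.ofReal_le_ofReal_iff (by positivity)] at h1
      rwa [div_le_iff₀' hC0]

/-- The manifold is covered by at most `C / r ^ m` balls of radius `r`. -/
theorem exists_cover [CompactSpace Y] : ∃ C : ℝ, 0 < C ∧ ∀ r : ℝ, 0 < r → r ≤ 1 →
    ∃ s : Finset Y, (s.card : ℝ) * r ^ m ≤ C ∧ ∀ y, ∃ x ∈ s, edist y x ≤ ENNReal.ofReal r := by
  classical
  obtain ⟨C, hC, H⟩ := exists_card_separated_le (m := m) (Y := Y)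
  refine ⟨C, hC, fun r hr hr1 => ?_⟩
  -- A separated set of maximal cardinality is an `r`-net, since a point far from it could be added.
  set A : Set ℕ := {n | ∃ s : Finset Y, s.card = n ∧
    ∀ x ∈ s, ∀ y ∈ s, x ≠ y → ENNReal.ofReal r ≤ edist x y} with hA
  have hne : A.Nonempty := ⟨0, ∅, by simp, by simp⟩
  have hbdd : BddAbove A := by
    refine ⟨⌈C / r ^ m⌉₊, ?_⟩
    rintro _ ⟨s, rfl, hs⟩
    have h1 := H r s hr hr1 hs
    rw [← le_div_iff₀ (by positivity)] at h1
    exact_mod_cast h1.trans (Nat.le_ceil _)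
  obtain ⟨s, hcard, hs⟩ := Nat.sSup_mem hne hbdd
  refine ⟨s, H r s hr hr1 hs, fun y => ?_⟩
  by_contra! hy
  have hys : y ∉ s := fun h => by simpa using hy y h
  have : (insert y s).card ∈ A := by
    refine ⟨_, rfl, fun x hx z hz hxz => ?_⟩
    rcases Finset.mem_insert.1 hx with rfl | hx'
    · rcases Finset.mem_insert.1 hz with rfl | hz'
      · exact absurd rfl hxz
      · exact (hy z hz').le
    · rcases Finset.mem_insert.1 hz with rfl | hz'
      · rw [edist_comm]
        exact (hy x hx').le
      · exact hs x hx' z hz' hxz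
  have := le_csSup hbdd this
  rw [Finset.card_insert_of_notMem hys, ← hcard] at this
  omega

/-! ### Expansion rate and shortest period. -/

theorem tangentNorm_flowDeriv_le_norm (t : ℝ) (y : Y) (v : 𝔼) :
    tangentNorm (φ t y) (flowDeriv φ t y v) ≤
      ‖mfderiv (𝓡 m) (𝓡 m) (φ t) y‖ * tangentNorm y v :=
  (mfderiv (𝓡 m) (𝓡 m) (φ t) y).le_opNorm (show TangentSpace (𝓡 m) y from v)

/-- Above the maximal expansion rate, the flow expands at most exponentially. -/
theorem eventually_norm_mfderiv_le {l : ℝ} (hl : maximalExpansionRate m φ < (l : EReal)) :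
    ∀ᶠ t : ℝ in atTop, ∀ y : Y, ‖mfderiv (𝓡 m) (𝓡 m) (φ t) y‖ ≤ Real.exp (l * t) := by
  filter_upwards [eventually_lt_of_limsup_lt hl, eventually_gt_atTop 0] with t ht ht0 y
  have h1 := (le_iSup (fun y : Y => ((t⁻¹ * Real.log ‖mfderiv (𝓡 m) (𝓡 m) (φ t) y‖ : ℝ) : EReal))
    y).trans_lt ht
  rw [EReal.coe_lt_coe_iff, inv_mul_lt_iff₀ ht0] at h1
  -- A zero norm is separated out, because `Real.log 0 = 0` carries no information.
  rcases (norm_nonneg (mfderiv (𝓡 m) (𝓡 m) (φ t) y)).eq_or_lt with h | h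
  · rw [← h]
    positivity
  · rw [← Real.exp_log h]
    exact Real.exp_le_exp.2 (by linarith)

/-- The flow preserves `V`, whose norm is bounded above and below, so its derivative cannot decay.
-/
theorem IsFlowOf.expansionRate_nonneg [CompactSpace Y] [Nonempty Y] (hφ : IsFlowOf φ V)
    (hVs : ContMDiff (𝓡 m) (𝓡 m).tangent ∞ (toSection V)) (hV : ∀ y, V y ≠ 0) {l : ℝ}
    (hl : maximalExpansionRate m φ < (l : EReal)) : 0 ≤ l := by
  obtain ⟨K, hK, H⟩ := exists_tangentNorm_modelVector_bound (m := m) hVs hV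
  by_contra! hneg
  have hlim : Tendsto (fun t : ℝ => Real.exp (l * t) * K) atTop (𝓝 (0 * K)) :=
    (Real.tendsto_exp_atBot.comp (tendsto_id.const_mul_atTop_of_neg hneg)).mul_const K
  rw [zero_mul] at hlim
  obtain ⟨t, h1, h2⟩ := ((eventually_norm_mfderiv_le hl).and
    (hlim.eventually_lt_const (inv_pos.2 hK))).exists
  obtain ⟨y⟩ := ‹Nonempty Y›
  have h3 := tangentNorm_flowDeriv_le_norm (φ := φ) t y (modelVector V y)
  rw [hφ.flowDeriv_vectorField] at h3
  have h4 : ‖mfderiv (𝓡 m) (𝓡 m) (φ t) y‖ * tangentNorm y (modelVector V y) ≤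
      Real.exp (l * t) * K :=
    mul_le_mul (h1 y) (H y).2 (tangentNorm_nonneg _ _) (Real.exp_pos _).le
  linarith [(H (φ t y)).1]

/-- The constant `C` covers the bounded time before the exponential rate is valid. -/
theorem IsFlowOf.exists_edist_le_exp [CompactSpace Y] (hφ : IsFlowOf φ V) {l : ℝ}
    (hl0 : 0 ≤ l) (hl : maximalExpansionRate m φ < (l : EReal)) :
    ∃ C : ℝ, 1 ≤ C ∧ ∀ t, 0 ≤ t → ∀ x y,
      edist (φ t x) (φ t y) ≤ ENNReal.ofReal (C * Real.exp (l * t)) * edist x y := by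
  obtain ⟨N, hN⟩ := eventually_atTop.1 (eventually_norm_mfderiv_le hl)
  obtain ⟨K, hK, H⟩ := hφ.exists_lipschitz N
  refine ⟨max 1 K, le_max_left _ _, fun t ht x y => ?_⟩
  have hexp : 1 ≤ Real.exp (l * t) := Real.one_le_exp (by positivity)
  rcases le_total t N with h | h
  · refine (H t (by rwa [abs_of_nonneg ht]) x y).trans ?_
    gcongr
    calc K = K * 1 := (mul_one K).symm
      _ ≤ max 1 K * Real.exp (l * t) := by gcongr; exact le_max_right _ _
  · refine (hφ.edist_le_of_tangentNorm_le (Real.exp_pos (l * t)) (fun y v => ?_) x y).trans ?_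
    · exact (tangentNorm_flowDeriv_le_norm t y v).trans
        (mul_le_mul_of_nonneg_right (hN t h y) (tangentNorm_nonneg y v))
    · gcongr
      exact le_mul_of_one_le_left (Real.exp_pos _).le (le_max_left _ _)

/-- A flow without fixed points has no short periods. -/
theorem IsFlowOf.exists_pos_le_of_shortestPeriod_le [CompactSpace Y] (hφ : IsFlowOf φ V)
    (hV : ∀ y, V y ≠ 0) :
    ∃ t₀ : ℝ, 0 < t₀ ∧ ∀ t : ℝ, shortestPeriod φ / 2 ≤ ENNReal.ofReal t → t₀ ≤ t := by
  obtain ⟨K, hK, H⟩ := hφ.exists_edist_time hV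
  refine ⟨K⁻¹ / 2, by positivity, fun t ht => ?_⟩
  have h1 : ENNReal.ofReal K⁻¹ ≤ shortestPeriod φ := by
    refine le_iInf₂ fun s hs => ENNReal.ofReal_le_ofReal ?_
    obtain ⟨hs0, y, hy⟩ := hs
    by_contra! hlt
    have h2 := (H y s (by rw [abs_of_pos hs0]; exact hlt.le)).1
    rw [hy, edist_self, nonpos_iff_eq_zero, ENNReal.ofReal_eq_zero, abs_of_pos hs0] at h2
    have : 0 < K⁻¹ * s := by positivity
    linarith
  have h2 : ENNReal.ofReal (K⁻¹ / 2) ≤ ENNReal.ofReal t := by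
    rw [ENNReal.ofReal_div_of_pos two_pos, ENNReal.ofReal_ofNat]
    exact (ENNReal.div_le_div_right h1 2).trans ht
  by_contra! hlt
  exact absurd h2 (not_le.2 ((ENNReal.ofReal_lt_ofReal_iff (by positivity)).2 hlt))

/-! ### Flow tubes and the covering of the recurrence set. -/

/-- The volume of a short flow tube. -/
theorem IsFlowOf.exists_volume_tube_le [CompactSpace Y] [MeasurableSpace Y] [BorelSpace Y]
    (hφ : IsFlowOf φ V) (hV : ∀ y, V y ≠ 0) (hm : 1 ≤ m) :
    ∃ K : ℝ, 0 < K ∧ ∀ x η, 0 < η → η ≤ K⁻¹ →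
      riemannianVolume Y m {y | ∃ σ, |σ| ≤ 1 ∧ edist (φ σ y) x ≤ ENNReal.ofReal η} ≤
        ENNReal.ofReal (K * η ^ (m - 1)) := by
  obtain ⟨L, hL, HL⟩ := hφ.exists_lipschitz 2
  obtain ⟨Kt, hKt, Ht⟩ := hφ.exists_edist_time hV
  obtain ⟨Kv, hKv, Hv⟩ := exists_volume_closedEBall_le (m := m) (Y := Y)
  set A := L * (Kt + 1) with hA
  have hA0 : 0 < A := by positivity
  set K := max (max 1 Kt) (max (A * Kv) (5 * Kv * A ^ m)) with hK
  have hK0 : 0 < K := lt_of_lt_of_le one_pos ((le_max_left _ _).trans (le_max_left _ _))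
  refine ⟨K, hK0, fun x η hη hηK => ?_⟩
  have hle {a : ℝ} (ha : 0 < a) (h : a ≤ K) : η ≤ a⁻¹ := hηK.trans (inv_anti₀ ha h)
  have hη1 : η ≤ 1 := by
    simpa using hle one_pos ((le_max_left _ _).trans (le_max_left _ _))
  have hηt : η ≤ Kt⁻¹ := hle hKt ((le_max_right _ _).trans (le_max_left _ _))
  have hηv : A * η ≤ Kv⁻¹ := by
    have := hle (by positivity) ((le_max_left (A * Kv) _).trans (le_max_right (max 1 Kt) _))
    rw [mul_inv] at this
    calc A * η ≤ A * (A⁻¹ * Kv⁻¹) := by gcongr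
      _ = Kv⁻¹ := by field_simp
  -- Times in `[-1, 1]` are rounded down to multiples of `η`. The tube is covered by `O(1 / η)`
  -- balls of radius `A η`: rounding costs `Kt η`, and flowing back for a time at most 2 multiplies
  -- by `L`.
  set n : ℤ := ⌈η⁻¹⌉ with hn
  have hn0 : 0 ≤ n := Int.ceil_nonneg (by positivity)
  have hnη : n * η ≤ 1 + η := by
    calc (n : ℝ) * η ≤ (η⁻¹ + 1) * η := by gcongr; exact (Int.ceil_lt_add_one _).le
      _ = 1 + η := by field_simp
  have hsub : {y | ∃ σ, |σ| ≤ 1 ∧ edist (φ σ y) x ≤ ENNReal.ofReal η} ⊆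
      ⋃ l ∈ Finset.Icc (-n) n,
        Metric.closedEBall (φ (-(l * η)) x) (ENNReal.ofReal (A * η)) := by
    rintro y ⟨σ, hσ, hy⟩
    have hσn : |σ / η| ≤ n := by
      rw [abs_div, abs_of_pos hη, div_eq_mul_inv]
      calc |σ| * η⁻¹ ≤ 1 * η⁻¹ := by gcongr
        _ ≤ n := by rw [one_mul]; exact Int.le_ceil _
    have hl : ⌊σ / η⌋ ∈ Finset.Icc (-n) n := by
      refine Finset.mem_Icc.2 ⟨Int.le_floor.2 ?_, Int.floor_le_iff.2 ?_⟩
      · push_cast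
        exact (abs_le.1 hσn).1
      · linarith [(abs_le.1 hσn).2]
    refine mem_iUnion₂.2 ⟨_, hl, ?_⟩
    set l := ⌊σ / η⌋
    have hlη : |l * η| ≤ 2 := by
      rw [abs_mul, abs_of_pos hη]
      have : |(l : ℝ)| ≤ n := by
        exact_mod_cast abs_le.2 ⟨(Finset.mem_Icc.1 hl).1, (Finset.mem_Icc.1 hl).2⟩
      nlinarith
    have hβ : |l * η - σ| ≤ η := by
      have h1 := Int.floor_le (σ / η)
      have h2 := Int.lt_floor_add_one (σ / η)
      rw [le_div_iff₀ hη] at h1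
      rw [div_lt_iff₀ hη] at h2
      rw [abs_le]
      constructor <;> linarith
    have h1 := (Ht (φ σ y) (l * η - σ) (hβ.trans hηt)).2
    rw [← φ.map_add, sub_add_cancel] at h1
    have h2 : edist (φ (l * η) y) x ≤ ENNReal.ofReal ((Kt + 1) * η) := by
      refine (edist_triangle _ (φ σ y) _).trans ?_
      rw [add_mul, one_mul, ENNReal.ofReal_add (by positivity) hη.le]
      refine add_le_add (h1.trans ?_) hy
      gcongr
    have h3 := HL (-(l * η)) (by rwa [abs_neg]) (φ (l * η) y) x
    rw [← φ.map_add, neg_add_cancel, φ.map_zero_apply] at h3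
    refine h3.trans ?_
    rw [hA, mul_assoc, ENNReal.ofReal_mul hL.le]
    gcongr
  have hcard : ((Finset.Icc (-n) n).card : ℝ) * η ≤ 5 := by
    have : ((Finset.Icc (-n) n).card : ℝ) = 2 * n + 1 := by
      rw [Int.card_Icc]
      have : ((n + 1 - -n).toNat : ℤ) = 2 * n + 1 := by omega
      exact_mod_cast this
    rw [this]
    linarith
  calc _ ≤ riemannianVolume Y m (⋃ l ∈ Finset.Icc (-n) n,
        Metric.closedEBall (φ (-(l * η)) x) (ENNReal.ofReal (A * η))) := measure_mono hsub
    _ ≤ ∑ l ∈ Finset.Icc (-n) n, riemannianVolume Y m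
        (Metric.closedEBall (φ (-(l * η)) x) (ENNReal.ofReal (A * η))) :=
      measure_biUnion_finset_le _ _
    _ ≤ ∑ l ∈ Finset.Icc (-n) n, ENNReal.ofReal (Kv * (A * η) ^ m) :=
      Finset.sum_le_sum fun l _ => Hv _ _ (by positivity) hηv
    _ = ENNReal.ofReal ((Finset.Icc (-n) n).card * (Kv * (A * η) ^ m)) := by
      rw [Finset.sum_const, nsmul_eq_mul, ENNReal.ofReal_mul (Nat.cast_nonneg _),
        ENNReal.ofReal_natCast]
    _ ≤ _ := by
      refine ENNReal.ofReal_le_ofReal ?_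
      have hpow : η ^ m = η * η ^ (m - 1) := by
        rw [← pow_succ', Nat.sub_add_cancel hm]
      calc _ = ((Finset.Icc (-n) n).card * η) * (Kv * A ^ m * η ^ (m - 1)) := by
            rw [mul_pow, hpow]; ring
        _ ≤ 5 * (Kv * A ^ m * η ^ (m - 1)) := by gcongr
        _ = 5 * Kv * A ^ m * η ^ (m - 1) := by ring
        _ ≤ K * η ^ (m - 1) := by
          gcongr
          exact (le_max_right _ _).trans (le_max_right _ _)

/-- The extended recurrence set is covered by at most `C (T + 1) exp (m l T)` flow tubes of
width `O(ε)`. -/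
theorem IsAnosov.exists_tube_cover [CompactSpace Y] (hA : IsAnosov φ V) (hφ : IsFlowOf φ V)
    (hVs : ContMDiff (𝓡 m) (𝓡 m).tangent ∞ (toSection V)) {l : ℝ} (hl0 : 0 ≤ l)
    (hl : maximalExpansionRate m φ < (l : EReal)) :
    ∃ C : ℝ, 0 < C ∧ ∀ T ε, 0 ≤ T → 0 < ε → ∃ s : Finset Y,
      (s.card : ℝ) ≤ C * (T + 1) * Real.exp (m * l * T) ∧
      ∀ y ∈ extendedRecurrenceSet φ T ε, ∃ x ∈ s, ∃ σ, |σ| ≤ 1 ∧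
        edist (φ σ y) x ≤ ENNReal.ofReal (C * ε) := by
  classical
  obtain ⟨t₀, ht₀, Ht₀⟩ := hφ.exists_pos_le_of_shortestPeriod_le hA.1
  obtain ⟨δ, K, hδ, hK, Hcl⟩ := hA.exists_closing hφ hVs ht₀
  obtain ⟨B, hB, HB⟩ := hφ.exists_edist_le_exp hl0 hl
  obtain ⟨L, hL, HL⟩ := hφ.exists_lipschitz 1
  obtain ⟨D, hD, HD⟩ := exists_cover (m := m) (Y := Y)
  have hB0 : 0 < B := by linarith
  -- Chosen so that two points of a ball of radius `ρ exp (-l T)` are still within `B * (2 * ρ) ≤ δ`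
  -- after any time up to `T`.
  set ρ := min 1 (δ / (2 * B)) with hρ
  have hρ0 : 0 < ρ := lt_min one_pos (by positivity)
  have hρB : B * (2 * ρ) ≤ δ := by
    calc B * (2 * ρ) ≤ B * (2 * (δ / (2 * B))) := by gcongr; exact min_le_right _ _
      _ = δ := by field_simp
  set C := max (D / ρ ^ m * (δ⁻¹ + 1)) (L * 2 + K) with hC
  refine ⟨C, lt_of_lt_of_le (by positivity) (le_max_right _ _), fun T ε hT hε => ?_⟩
  set r := ρ * Real.exp (-(l * T)) with hr
  have hr0 : 0 < r := by positivity
  have hexp : Real.exp (-(l * T)) ≤ 1 := Real.exp_le_one_iff.2 (by simp; positivity)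
  obtain ⟨s₀, hcard, hs₀⟩ := HD r hr0 (mul_le_one₀ (min_le_left _ _) (Real.exp_pos _).le hexp)
  -- For each ball and window one recurrent point is selected, if there is any; the closing estimate
  -- puts all others in its tube.
  have hex (p : Y × ℕ) : ∃ x : Y, ∀ x' t', (x', t') ∈ liftedRecurrenceSet φ T ε →
      edist x' p.1 ≤ ENNReal.ofReal r → ⌊t' / δ⌋₊ = p.2 →
      ∃ σ, |σ| ≤ 1 ∧ edist (φ σ x') x ≤ ENNReal.ofReal (K * ε) := by
    by_cases h : ∃ x t, (x, t) ∈ liftedRecurrenceSet φ T ε ∧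
      edist x p.1 ≤ ENNReal.ofReal r ∧ ⌊t / δ⌋₊ = p.2
    · obtain ⟨x, t, ⟨h0, h1, h2, h3⟩, h4, h5⟩ := h
      refine ⟨x, fun x' t' ⟨h0', h1', h2', h3'⟩ h4' h5' => ?_⟩
      dsimp only at h0 h1 h2 h3 h0' h1' h2' h3'
      refine Hcl ε x x' t t' hε (Ht₀ t h1) ?_ h3 h3' fun s hs => ?_
      · have e1 := Nat.floor_le (div_nonneg h0 hδ.le)
        have e2 := Nat.lt_floor_add_one (t / δ)
        have e1' := Nat.floor_le (div_nonneg h0' hδ.le)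
        have e2' := Nat.lt_floor_add_one (t' / δ)
        rw [h5] at e1 e2
        rw [h5'] at e1' e2'
        rw [le_div_iff₀ hδ] at e1 e1'
        rw [div_lt_iff₀ hδ] at e2 e2'
        rw [abs_le]
        constructor <;> linarith
      · have e : edist x' x ≤ ENNReal.ofReal (2 * r) := by
          rw [two_mul, ENNReal.ofReal_add hr0.le hr0.le]
          exact (edist_triangle_right _ _ p.1).trans (add_le_add h4' h4)
        refine (HB s hs.1 x' x).trans ?_
        calc _ ≤ ENNReal.ofReal (B * Real.exp (l * s)) * ENNReal.ofReal (2 * r) := by gcongr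
          _ = ENNReal.ofReal (B * Real.exp (l * s) * (2 * r)) :=
            (ENNReal.ofReal_mul (by positivity)).symm
          _ ≤ ENNReal.ofReal (B * Real.exp (l * T) * (2 * r)) := by
            gcongr
            exact hs.2.trans h2
          _ = ENNReal.ofReal (B * (2 * ρ)) := by
            congr 1
            rw [hr, Real.exp_neg]
            field_simp
          _ ≤ ENNReal.ofReal δ := ENNReal.ofReal_le_ofReal hρB
    · push Not at h
      exact ⟨p.1, fun x' t' h0 h1 h2 => absurd h2 (h x' t' h0 h1)⟩
  choose f hf using hex
  refine ⟨(s₀ ×ˢ Finset.range (⌊T / δ⌋₊ + 1)).image f, ?_, fun y hy => ?_⟩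
  · have e1 : ((s₀ ×ˢ Finset.range (⌊T / δ⌋₊ + 1)).card : ℝ) = s₀.card * (⌊T / δ⌋₊ + 1) := by
      simp [Finset.card_product]
    have e2 : (⌊T / δ⌋₊ : ℝ) + 1 ≤ (δ⁻¹ + 1) * (T + 1) := by
      have := Nat.floor_le (div_nonneg hT hδ.le)
      have : 0 ≤ δ⁻¹ := by positivity
      rw [div_eq_mul_inv] at *
      nlinarith
    have e3 : (s₀.card : ℝ) ≤ D / ρ ^ m * Real.exp (m * l * T) := by
      rw [hr, mul_pow, ← Real.exp_nat_mul] at hcard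
      calc (s₀.card : ℝ) = s₀.card * (ρ ^ m * Real.exp (m * -(l * T))) / ρ ^ m *
            Real.exp (m * l * T) := by
            rw [show (m : ℝ) * -(l * T) = -(m * l * T) by ring, Real.exp_neg]
            field_simp
        _ ≤ _ := by gcongr
    calc _ ≤ ((s₀ ×ˢ Finset.range (⌊T / δ⌋₊ + 1)).card : ℝ) := by
          exact_mod_cast Finset.card_image_le
      _ ≤ D / ρ ^ m * Real.exp (m * l * T) * ((δ⁻¹ + 1) * (T + 1)) := by
          rw [e1]; gcongr
      _ = D / ρ ^ m * (δ⁻¹ + 1) * (T + 1) * Real.exp (m * l * T) := by ring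
      _ ≤ _ := by gcongr; exact le_max_left _ _
  -- The infimum may not be attained, so `ε` is relaxed to `2 ε`; this is the source of `L * 2` in
  -- `C`.
  · have hlt : Metric.infEDist y (recurrenceSet φ T ε) < ENNReal.ofReal (2 * ε) :=
      lt_of_le_of_lt hy ((ENNReal.ofReal_lt_ofReal_iff (by positivity)).2 (by linarith))
    obtain ⟨x', ⟨t', hx'⟩, hyx⟩ := Metric.infEDist_lt_iff.1 hlt
    obtain ⟨c, hc, hcx⟩ := hs₀ x'
    have hk : ⌊t' / δ⌋₊ ∈ Finset.range (⌊T / δ⌋₊ + 1) := by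
      refine Finset.mem_range_succ_iff.2 (Nat.floor_le_floor ?_)
      have : t' ≤ T := hx'.2.2.1
      gcongr
    obtain ⟨σ, hσ, h⟩ := hf (c, ⌊t' / δ⌋₊) x' t' hx' hcx rfl
    refine ⟨_, Finset.mem_image_of_mem f (Finset.mk_mem_product hc hk), σ, hσ, ?_⟩
    calc _ ≤ edist (φ σ y) (φ σ x') + edist (φ σ x') (f (c, ⌊t' / δ⌋₊)) := edist_triangle _ _ _
      _ ≤ ENNReal.ofReal L * ENNReal.ofReal (2 * ε) + ENNReal.ofReal (K * ε) := by
        refine add_le_add ((HL σ hσ y x').trans ?_) h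
        gcongr
      _ = ENNReal.ofReal ((L * 2 + K) * ε) := by
        rw [← ENNReal.ofReal_mul hL.le, ← ENNReal.ofReal_add (by positivity) (by positivity)]
        ring_nf
      _ ≤ _ := by gcongr; exact le_max_right _ _

/-! ### Volume estimates and conclusion. -/

/-- One factor `T + 1` counts the windows of return times, the other comes from the time slices. -/
theorem exists_add_one_sq_le_exp {a : ℝ} (ha : 0 < a) :
    ∃ C : ℝ, 0 < C ∧ ∀ T, 0 ≤ T → (T + 1) ^ 2 ≤ C * Real.exp (a * T) := by
  set b := min 1 (a / 2)
  have hb : 0 < b := lt_min one_pos (half_pos ha)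
  have hb1 : b ≤ 1 := min_le_left _ _
  have hb2 : b ≤ a / 2 := min_le_right _ _
  refine ⟨(b ^ 2)⁻¹, by positivity, fun T hT => ?_⟩
  have h1 : b * (T + 1) ≤ Real.exp (b * T) := by
    linarith [Real.add_one_le_exp (b * T)]
  rw [← div_eq_inv_mul, le_div_iff₀ (by positivity)]
  calc (T + 1) ^ 2 * b ^ 2 = (b * (T + 1)) ^ 2 := by ring
    _ ≤ Real.exp (b * T) ^ 2 := by gcongr
    _ = Real.exp (2 * b * T) := by rw [← Real.exp_nat_mul]; push_cast; ring_nf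
    _ ≤ Real.exp (a * T) := by gcongr; linarith

theorem recurrenceSet_subset_extendedRecurrenceSet (φ : Flow ℝ Y) (T ε : ℝ) :
    recurrenceSet φ T ε ⊆ extendedRecurrenceSet φ T ε := fun y hy => by
  simp [extendedRecurrenceSet, Metric.infEDist_zero_of_mem hy]

theorem isClosed_liftedRecurrenceSet (φ : Flow ℝ Y) (T ε : ℝ) :
    IsClosed (liftedRecurrenceSet φ T ε) := by
  have h : Continuous fun p : Y × ℝ => φ p.2 p.1 := φ.continuous continuous_snd continuous_fst
  exact (isClosed_le continuous_const continuous_snd).inter <|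
    (isClosed_le continuous_const (ENNReal.continuous_ofReal.comp continuous_snd)).inter <|
    (isClosed_le continuous_snd continuous_const).inter <|
    isClosed_le (h.edist continuous_fst) continuous_const

theorem IsAnosov.exists_volume_extendedRecurrenceSet_le [CompactSpace Y] [MeasurableSpace Y]
    [BorelSpace Y] (hA : IsAnosov φ V) (hφ : IsFlowOf φ V)
    (hVs : ContMDiff (𝓡 m) (𝓡 m).tangent ∞ (toSection V)) (hm : 1 ≤ m) {l : ℝ} (hl0 : 0 ≤ l)
    (hl : maximalExpansionRate m φ < (l : EReal)) :
    ∃ C : ℝ, 0 < C ∧ ∀ T ε, 0 ≤ T → 0 < ε →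
      riemannianVolume Y m (extendedRecurrenceSet φ T ε) ≤
        ENNReal.ofReal (C * ε ^ (m - 1) * ((T + 1) * Real.exp (m * l * T))) := by
  obtain ⟨B, hB, HB⟩ := hA.exists_tube_cover hφ hVs hl0 hl
  obtain ⟨K, hK, HK⟩ := hφ.exists_volume_tube_le hA.1 hm
  have hM : ENNReal.ofReal (riemannianVolume Y m univ).toReal = riemannianVolume Y m univ :=
    ENNReal.ofReal_toReal riemannianVolume_univ_lt_top.ne
  set M := (riemannianVolume Y m univ).toReal
  have hM0 : 0 ≤ M := ENNReal.toReal_nonneg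
  set C := max (B * K * B ^ (m - 1)) (M * (B * K) ^ (m - 1))
  refine ⟨C, lt_of_lt_of_le (by positivity) (le_max_left _ _), fun T ε hT hε => ?_⟩
  rcases le_total (B * ε) K⁻¹ with h | h
  · obtain ⟨s, hcard, hs⟩ := HB T ε hT hε
    calc _ ≤ riemannianVolume Y m (⋃ x ∈ s,
          {y | ∃ σ, |σ| ≤ 1 ∧ edist (φ σ y) x ≤ ENNReal.ofReal (B * ε)}) :=
        measure_mono fun y hy => by simpa using hs y hy
      _ ≤ ∑ x ∈ s, riemannianVolume Y m
          {y | ∃ σ, |σ| ≤ 1 ∧ edist (φ σ y) x ≤ ENNReal.ofReal (B * ε)} :=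
        measure_biUnion_finset_le _ _
      _ ≤ ∑ x ∈ s, ENNReal.ofReal (K * (B * ε) ^ (m - 1)) :=
        Finset.sum_le_sum fun x _ => HK x _ (by positivity) h
      _ = ENNReal.ofReal (s.card * (K * (B * ε) ^ (m - 1))) := by
        rw [Finset.sum_const, nsmul_eq_mul, ENNReal.ofReal_mul (Nat.cast_nonneg _),
          ENNReal.ofReal_natCast]
      _ ≤ _ := by
        refine ENNReal.ofReal_le_ofReal ?_
        calc _ ≤ B * (T + 1) * Real.exp (m * l * T) * (K * (B * ε) ^ (m - 1)) := by gcongr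
          _ = B * K * B ^ (m - 1) * ε ^ (m - 1) * ((T + 1) * Real.exp (m * l * T)) := by
            rw [mul_pow]; ring
          _ ≤ _ := by gcongr; exact le_max_left _ _
  -- For `ε` too large for the tube estimate, `B K ε ≥ 1` and the total volume is bound enough.
  · refine (measure_mono (subset_univ _)).trans (hM.symm.le.trans (ENNReal.ofReal_le_ofReal ?_))
    have h1 : 1 ≤ B * K * ε := by
      rw [inv_le_iff_one_le_mul₀ hK] at h
      linarith
    have h2 : 1 ≤ (T + 1) * Real.exp (m * l * T) :=
      one_le_mul_of_one_le_of_one_le (by linarith) (Real.one_le_exp (by positivity))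
    calc M = M * 1 * 1 := by ring
      _ ≤ M * (B * K * ε) ^ (m - 1) * ((T + 1) * Real.exp (m * l * T)) := by
        gcongr; exact one_le_pow₀ h1
      _ = M * (B * K) ^ (m - 1) * ε ^ (m - 1) * ((T + 1) * Real.exp (m * l * T)) := by
        rw [mul_pow _ ε]; ring
      _ ≤ _ := by gcongr; exact le_max_right _ _

/-- The time slices of the lifted recurrence set have length `O(ε (T + 1))`. -/
theorem IsFlowOf.exists_volume_slice_le [CompactSpace Y] (hφ : IsFlowOf φ V)
    (hV : ∀ y, V y ≠ 0) : ∃ C : ℝ, 0 < C ∧ ∀ T ε x, 0 ≤ T → 0 < ε →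
      volume (Prod.mk x ⁻¹' liftedRecurrenceSet φ T ε) ≤ ENNReal.ofReal (C * ε * (T + 1)) := by
  obtain ⟨K, hK, H⟩ := hφ.exists_edist_time hV
  refine ⟨4 * K * (K + 1), by positivity, fun T ε x hT hε => ?_⟩
  set S := Prod.mk x ⁻¹' liftedRecurrenceSet φ T ε
  -- Two return times in a slab of length `K⁻¹` are in the range of the speed bound. Their points
  -- are `2 ε`-close, so the times differ by at most `2 K ε`.
  have hslab (k : ℕ) : volume (S ∩ {t | ⌊t * K⌋₊ = k}) ≤ ENNReal.ofReal (4 * K * ε) := by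
    rcases (S ∩ {t | ⌊t * K⌋₊ = k}).eq_empty_or_nonempty with h | ⟨t, ⟨h0, -, -, h3⟩, hk⟩
    · simp [h]
    · have hsub : S ∩ {t | ⌊t * K⌋₊ = k} ⊆ Metric.closedBall t (2 * K * ε) := by
        rintro t' ⟨⟨h0', -, -, h3'⟩, hk'⟩
        dsimp only at h0 h3 h0' h3'
        rw [mem_ofPred_eq] at hk hk'
        have hβ : |t' - t| ≤ K⁻¹ := by
          have e1 := Nat.floor_le (mul_nonneg h0 hK.le)
          have e2 := Nat.lt_floor_add_one (t * K)
          have e1' := Nat.floor_le (mul_nonneg h0' hK.le)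
          have e2' := Nat.lt_floor_add_one (t' * K)
          rw [hk] at e1 e2
          rw [hk'] at e1' e2'
          rw [← one_div, le_div_iff₀ hK]
          calc |t' - t| * K = |(t' - t) * K| := by rw [abs_mul, abs_of_pos hK]
            _ ≤ 1 := abs_le.2 ⟨by linarith, by linarith⟩
        have h1 := (H (φ t x) (t' - t) hβ).1
        rw [← φ.map_add, sub_add_cancel] at h1
        have h2 : ENNReal.ofReal (K⁻¹ * |t' - t|) ≤ ENNReal.ofReal (2 * ε) := by
          rw [two_mul, ENNReal.ofReal_add hε.le hε.le]
          exact h1.trans ((edist_triangle_right _ _ x).trans (add_le_add h3' h3))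
        rw [ENNReal.ofReal_le_ofReal_iff (by positivity), inv_mul_le_iff₀ hK] at h2
        rw [Metric.mem_closedBall, Real.dist_eq]
        linarith
      refine (measure_mono hsub).trans ?_
      rw [Real.volume_closedBall]
      exact ENNReal.ofReal_le_ofReal (by linarith)
  have hsub : S ⊆ ⋃ k ∈ Finset.range (⌊T * K⌋₊ + 1), S ∩ {t | ⌊t * K⌋₊ = k} := fun t ht => by
    refine mem_iUnion₂.2 ⟨⌊t * K⌋₊, Finset.mem_range_succ_iff.2 (Nat.floor_le_floor ?_), ht, rfl⟩
    exact mul_le_mul_of_nonneg_right ht.2.2.1 hK.le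
  calc _ ≤ ∑ k ∈ Finset.range (⌊T * K⌋₊ + 1), volume (S ∩ {t | ⌊t * K⌋₊ = k}) :=
        (measure_mono hsub).trans (measure_biUnion_finset_le _ _)
    _ ≤ ∑ k ∈ Finset.range (⌊T * K⌋₊ + 1), ENNReal.ofReal (4 * K * ε) :=
        Finset.sum_le_sum fun k _ => hslab k
    _ = ENNReal.ofReal ((⌊T * K⌋₊ + 1 : ℕ) * (4 * K * ε)) := by
        rw [Finset.sum_const, nsmul_eq_mul, ENNReal.ofReal_mul (Nat.cast_nonneg _),
          ENNReal.ofReal_natCast, Finset.card_range]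
    _ ≤ _ := by
        refine ENNReal.ofReal_le_ofReal ?_
        have h1 := Nat.floor_le (mul_nonneg hT hK.le)
        have h2 : ((⌊T * K⌋₊ + 1 : ℕ) : ℝ) ≤ (K + 1) * (T + 1) := by
          push_cast
          nlinarith
        calc _ ≤ (K + 1) * (T + 1) * (4 * K * ε) := by gcongr
          _ = _ := by ring

end FlowGeometry

end AnosovRecurrence

end

open AnosovRecurrence in
theorem mainTheorem8 {m : ℕ} {Y : Type*} [EMetricSpace Y] [CompactSpace Y]
    [ChartedSpace (EuclideanSpace ℝ (Fin m)) Y] [IsManifold (𝓡 m) ∞ Y]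
    [RiemannianBundle (fun y : Y => TangentSpace (𝓡 m) y)]
    [IsContMDiffRiemannianBundle (𝓡 m) ∞ (EuclideanSpace ℝ (Fin m))
      (fun y : Y => TangentSpace (𝓡 m) y)]
    [IsRiemannianManifold (𝓡 m) Y]
    [MeasurableSpace Y] [BorelSpace Y]
    (V : ∀ y : Y, TangentSpace (𝓡 m) y)
    (hV : ContMDiff (𝓡 m) (𝓡 m).tangent ∞ (AnosovRecurrence.toSection V))
    (φ : Flow ℝ Y) (hφ : AnosovRecurrence.IsFlowOf φ V)
    (hA : AnosovRecurrence.IsAnosov φ V)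
    (lam : ℝ) (hlam : AnosovRecurrence.maximalExpansionRate m φ < (lam : EReal)) :
    ∃ C : ℝ, 0 < C ∧ ∀ ε : ℝ, 0 < ε → ∀ T : ℝ,
      AnosovRecurrence.shortestPeriod φ / 2 < ENNReal.ofReal T →
      ((AnosovRecurrence.riemannianVolume Y m).prod volume)
          (AnosovRecurrence.liftedRecurrenceSet φ T ε)
        ≤ ENNReal.ofReal (C * ε ^ m * Real.exp (m * lam * T)) ∧
      AnosovRecurrence.riemannianVolume Y m (AnosovRecurrence.recurrenceSet φ T ε)
        ≤ ENNReal.ofReal (C * ε ^ (m - 1) * Real.exp (m * lam * T)) ∧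
      AnosovRecurrence.riemannianVolume Y m (AnosovRecurrence.extendedRecurrenceSet φ T ε)
        ≤ ENNReal.ofReal (C * ε ^ (m - 1) * Real.exp (m * lam * T)) := by
  rcases isEmpty_or_nonempty Y with hY | hY
  -- On the empty manifold the shortest period is `⊤`, so no `T` is admissible.
  · refine ⟨1, one_pos, fun ε _ T hT => absurd hT ?_⟩
    have : shortestPeriod φ = ⊤ := by simp [shortestPeriod]
    simp [this, ENNReal.top_div_of_ne_top]
  have hm : 1 ≤ m := by
    obtain ⟨y⟩ := hY
    by_contra! h
    obtain rfl : m = 0 := by omega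
    exact hA.1 y (Subsingleton.elim (α := EuclideanSpace ℝ (Fin 0)) _ _)
  -- The gap `lam - l` pays for the polynomial factor in `T`.
  obtain ⟨l, hl, hll⟩ := EReal.lt_iff_exists_real_btwn.1 hlam
  rw [EReal.coe_lt_coe_iff] at hll
  have hl0 : 0 ≤ l := hφ.expansionRate_nonneg hV hA.1 hl
  obtain ⟨t₀, ht₀, Ht₀⟩ := hφ.exists_pos_le_of_shortestPeriod_le hA.1
  obtain ⟨A, hA0, HA⟩ := hA.exists_volume_extendedRecurrenceSet_le hφ hV hm hl0 hl
  obtain ⟨B, hB0, HB⟩ := hφ.exists_volume_slice_le hA.1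
  have hm0 : (0 : ℝ) < m := by exact_mod_cast hm
  obtain ⟨D, hD0, HD⟩ := exists_add_one_sq_le_exp (mul_pos hm0 (sub_pos.2 hll))
  refine ⟨max (A * D) (A * B * D), lt_of_lt_of_le (by positivity) (le_max_left _ _),
    fun ε hε T hT => ?_⟩
  have hT0 : 0 ≤ T := ht₀.le.trans (Ht₀ T hT.le)
  have hexp : (T + 1) ^ 2 * Real.exp (m * l * T) ≤ D * Real.exp (m * lam * T) := by
    calc _ ≤ D * Real.exp (m * (lam - l) * T) * Real.exp (m * l * T) := by
          gcongr; exact HD T hT0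
      _ = _ := by rw [mul_assoc, ← Real.exp_add]; ring_nf
  have hext : riemannianVolume Y m (extendedRecurrenceSet φ T ε) ≤
      ENNReal.ofReal (max (A * D) (A * B * D) * ε ^ (m - 1) * Real.exp (m * lam * T)) := by
    refine (HA T ε hT0 hε).trans (ENNReal.ofReal_le_ofReal ?_)
    calc _ ≤ A * ε ^ (m - 1) * ((T + 1) ^ 2 * Real.exp (m * l * T)) := by
          gcongr; nlinarith
      _ ≤ A * ε ^ (m - 1) * (D * Real.exp (m * lam * T)) := by gcongr
      _ = A * D * ε ^ (m - 1) * Real.exp (m * lam * T) := by ring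
      _ ≤ _ := by gcongr; exact le_max_left _ _
  have hsub := recurrenceSet_subset_extendedRecurrenceSet φ T ε
  refine ⟨?_, (measure_mono hsub).trans hext, hext⟩
  -- Fubini: a slice is empty off `recurrenceSet` and of length at most `B ε (T + 1)` on it. The
  -- upper bound for the integral of an indicator does not require that set to be measurable.
  rw [Measure.prod_apply (isClosed_liftedRecurrenceSet φ T ε).measurableSet]
  calc _ ≤ ∫⁻ y, (recurrenceSet φ T ε).indicator
        (fun _ => ENNReal.ofReal (B * ε * (T + 1))) y ∂riemannianVolume Y m := by
        refine lintegral_mono fun y => ?_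
        by_cases hy : y ∈ recurrenceSet φ T ε
        · rw [indicator_of_mem hy]
          exact HB T ε y hT0 hε
        · have : Prod.mk y ⁻¹' liftedRecurrenceSet φ T ε = ∅ :=
            eq_empty_of_forall_notMem fun t ht => hy ⟨t, ht⟩
          simp [this]
    _ ≤ ENNReal.ofReal (B * ε * (T + 1)) * riemannianVolume Y m (recurrenceSet φ T ε) :=
        lintegral_indicator_const_le _ _
    _ ≤ ENNReal.ofReal (B * ε * (T + 1)) *
        ENNReal.ofReal (A * ε ^ (m - 1) * ((T + 1) * Real.exp (m * l * T))) := by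
        gcongr
        exact (measure_mono hsub).trans (HA T ε hT0 hε)
    _ ≤ _ := by
        rw [← ENNReal.ofReal_mul (by positivity)]
        refine ENNReal.ofReal_le_ofReal ?_
        have hpow : ε ^ m = ε * ε ^ (m - 1) := by rw [← pow_succ', Nat.sub_add_cancel hm]
        calc _ = A * B * ε ^ m * ((T + 1) ^ 2 * Real.exp (m * l * T)) := by rw [hpow]; ring
          _ ≤ A * B * ε ^ m * (D * Real.exp (m * lam * T)) := by gcongr
          _ = A * B * D * ε ^ m * Real.exp (m * lam * T) := by ring
          _ ≤ _ := by gcongr; exact le_max_right _ _
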